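/- (Davidson's model.) Fix $\theta>0$ and an integer $T\ge 1$, and let $$f(1;y)=\frac{e^{y}}{e^{y}+\theta e^{y/2}+1},\qquad f(0;y)=\frac{\theta e^{y/2}}{e^{y}+\theta e^{y/2}+1},\qquad f(-1;y)=\frac{1}{e^{y}+\theta e^{y/2}+1}.$$ There is a constant $C>0$ depending only on $\theta$ and $T$ such that the following holds. For every $n$ let $p_n\in[0,1]$ and let $\mathbf u=\mathbf u^{(n)}\in\mathbb R^n$ be a score vector with $u_1=0$ and dynamic range $M_n=\max_{i,j}|u_i-u_j|$. For every $n$, let the numbers of comparisons $n_{ij}$, $1\le i<j\le n$, be independent with law $\mathrm{Bin}(T,p_n)$, and, given them, let the outcomes $X_{ij}^{(t)}\in\{-1,0,1\}$ ($1\le t\le n_{ij}$) be independent with $\mathbb P(X_{ij}^{(t)}=x)=f(x;u_i-u_j)$; the data for all $n$ live on one probability space, with an arbitrary joint law across different $n$. Call $\hat{\mathbf u}$ a maximum likelihood estimate (MLE) if it maximizes $$l(\mathbf v)=\sum_{1\le i<j\le n}\ \sum_{t=1}^{n_{ij}}\log f\bigl(X_{ij}^{(t)};v_i-v_j\bigr)$$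 over all $\mathbf v\in\mathbb R^n$ with $v_1=0$. Suppose that there is $c>1$ with $p_n\ge c\,n^{-1}\log n$ for all large $n$, and that $$\Delta_n:=e^{M_n}\sqrt{\frac{\log n}{np_n}}\;\frac{\log n}{\log (np_n)}\longrightarrow 0\qquad(n\to\infty).$$ Then the MLE is a (strongly) uniformly consistent estimator of $\mathbf u$: 1. for all sufficiently large $n$, with probability at least $1-14n^{-2}$, the MLE $\hat{\mathbf u}$ exists, is unique, and satisfies $\|\hat{\mathbf u}-\mathbf u\|_\infty\le C\Delta_n$; 2. almost surely, the MLE exists and is unique for all but finitely many $n$, and $\|\hat{\mathbf u}-\mathbf u\|_\infty\to 0$ as $n\to\infty$. -/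

import Mathlib

open MeasureTheory ProbabilityTheory Filter Topology

noncomputable section

/-- Davidson's link function: the probability of the outcome `x` (`1` win, `0` tie, `-1` loss)
of a comparison with relative score `y`, for the threshold parameter `θ`. -/
def davidson (θ : ℝ) (x : ℤ) (y : ℝ) : ℝ :=
  if x = 1 then Real.exp y / (Real.exp y + θ * Real.exp (y / 2) + 1)
  else if x = 0 then θ * Real.exp (y / 2) / (Real.exp y + θ * Real.exp (y / 2) + 1)
  else if x = -1 then 1 / (Real.exp y + θ * Real.exp (y / 2) + 1)
  else 0

/-- The unordered pairs of distinct subjects, written as ordered pairs `i < j`. -/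
abbrev SubjectPair (n : ℕ) : Type := {e : Fin n × Fin n // e.1 < e.2}

/-- The relative score `v i - v j` of the pair `i < j`. -/
def relScore {n : ℕ} (v : Fin n → ℝ) (e : SubjectPair n) : ℝ := v e.1.1 - v e.1.2

/-- The score vectors whose first coordinate is zero. -/
def normalizedScores (n : ℕ) : Set (Fin n → ℝ) :=
  {v | ∀ i : Fin n, (i : ℕ) = 0 → v i = 0}

/-- The dynamic range `max_{i,j} |u i - u j|`. -/
def dynamicRange {n : ℕ} (u : Fin n → ℝ) : ℝ := ⨆ q : Fin n × Fin n, |u q.1 - u q.2|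

/-- The random comparison data of Davidson's model on `n` subjects with score vector `u`:
`N e` is the number of comparisons of the pair `e`, and `X e t` for `t < N e` are their outcomes.
The counts are independent with law `Bin(T, p)`; the outcomes are independent of each other and of
the counts, the outcome for the pair `i < j` having mass function `davidson θ · (u i - u j)`.
(Outcomes `X e t` with `N e ≤ t` are not observed.) -/
structure IsDavidsonData {Ω : Type*} [MeasurableSpace Ω] (μ : Measure Ω) (θ : ℝ) (T : ℕ)
    (p : unitInterval) {n : ℕ} (u : Fin n → ℝ)
    (N : SubjectPair n → Ω → ℕ) (X : SubjectPair n → Fin T → Ω → ℤ) : Prop where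
  measurable_count : ∀ e, Measurable (N e)
  measurable_outcome : ∀ e t, Measurable (X e t)
  law_count : ∀ e, HasLaw (N e) (ProbabilityTheory.binomial T p) μ
  law_outcome : ∀ e t, ∀ x ∈ ({-1, 0, 1} : Set ℤ),
    μ.real {ω | X e t ω = x} = davidson θ x (relScore u e)
  indep_count : iIndepFun N μ
  indep_outcome : iIndepFun (fun q : SubjectPair n × Fin T => X q.1 q.2) μ
  indep_count_outcome :
    IndepFun (fun ω e => N e ω) (fun ω (q : SubjectPair n × Fin T) => X q.1 q.2 ω) μ

/-- The conditional log-likelihood `∑_{i<j} ∑_{t < N i j} log f(X i j t; v i - v j)` of the score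
vector `v`, given the observed counts `N` and outcomes `X`. -/
def logLikelihood (θ : ℝ) {T n : ℕ} (N : SubjectPair n → ℕ) (X : SubjectPair n → Fin T → ℤ)
    (v : Fin n → ℝ) : ℝ :=
  ∑ e : SubjectPair n, ∑ t ∈ Finset.univ.filter (fun t : Fin T => (t : ℕ) < N e),
    Real.log (davidson θ (X e t) (relScore v e))

/-- `v` is a maximum likelihood estimate: a maximizer of the log-likelihood among all score
vectors whose first coordinate is zero. -/
def IsMLE (θ : ℝ) {T n : ℕ} (N : SubjectPair n → ℕ) (X : SubjectPair n → Fin T → ℤ)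
    (v : Fin n → ℝ) : Prop :=
  v ∈ normalizedScores n ∧ IsMaxOn (logLikelihood θ N X) (normalizedScores n) v

/-- The rate `Δ_n = e^M √(log n / (n p)) · log n / log (n p)`. -/
def davidsonRate (n : ℕ) (p M : ℝ) : ℝ :=
  Real.exp M * √(Real.log n / (n * p)) * (Real.log n / Real.log (n * p))

end

/-
Let `δ = v - u`, where `v` maximizes the log-likelihood over the score vectors with
`dynamicRange (v - u) ≤ 1`. Raising all subjects outside an upper level set of `δ`, or those in an
upper level set of `-δ`, does not leave this region at first order, even if its constraint is
active. So the derivative of the log-likelihood at `v` in such a direction is nonpositive, and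
since the log-likelihood is strongly concave in the relative scores on bounded sets, the total
discrepancy of `δ` across the cut between the level set and its complement is bounded by the
derivative at the truth `u`, which is pure noise.

On the other hand, the comparison graph is an expander: a set of subjects sends too much weight out
of every enlargement by a factor at most `K = √(n p)`. Hence the level sets `{δ ≥ s - k d}` grow at
least by the factor `K` in each step `k`, where `d` is a multiple of the noise level, until they
contain more than half of all subjects after about `2 log n / log (n p)` steps. The same holds for
`-δ`; as two sets of more than half of the subjects meet, this bounds `dynamicRange δ` by the
announced rate. As this is less than `1`, the constraint is inactive, and by concavity `v` is a
global maximizer. Union bounds over all cuts show that expansion and noise bounds hold with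
probability at least `1 - 14 / n ^ 2`, which is summable, and Borel–Cantelli gives the almost sure
statements.
-/

noncomputable section

section Cuts

variable {n : ℕ}

/-- The pairs with one subject in `U` and the other one in `V`. -/
def pairsBetween (U V : Finset (Fin n)) : Finset (SubjectPair n) :=
  Finset.univ.filter fun e => (e.1.1 ∈ U ∧ e.1.2 ∈ V) ∨ (e.1.2 ∈ U ∧ e.1.1 ∈ V)

theorem mem_pairsBetween {U V : Finset (Fin n)} {e : SubjectPair n} :
    e ∈ pairsBetween U V ↔ (e.1.1 ∈ U ∧ e.1.2 ∈ V) ∨ (e.1.2 ∈ U ∧ e.1.1 ∈ V) := by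
  simp [pairsBetween]

theorem pairsBetween_comm (U V : Finset (Fin n)) : pairsBetween U V = pairsBetween V U := by
  ext e
  simp only [mem_pairsBetween]
  tauto

theorem pairsBetween_mono_right (U : Finset (Fin n)) {V V' : Finset (Fin n)} (h : V ⊆ V') :
    pairsBetween U V ⊆ pairsBetween U V' := fun e he => by
  rw [mem_pairsBetween] at he ⊢
  exact he.imp (.imp_right (@h _)) (.imp_right (@h _))

theorem card_pairsBetween {U V : Finset (Fin n)} (h : Disjoint U V) :
    (pairsBetween U V).card = U.card * V.card := by
  have hUV : ∀ i ∈ U, i ∉ V := fun i hi hi' => Finset.disjoint_left.1 h hi hi'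
  rw [← Finset.card_product]
  refine Finset.card_bij (fun e _ => if e.1.1 ∈ U then e.1 else e.1.swap) ?_ ?_ ?_
  · intro e he
    rw [mem_pairsBetween] at he
    grind
  · rintro ⟨⟨a, b⟩, hab⟩ he ⟨⟨a', b'⟩, hab'⟩ he' heq
    rw [mem_pairsBetween] at he he'
    grind
  · rintro ⟨a, b⟩ hab
    rw [Finset.mem_product] at hab
    have hne : a ≠ b := fun hh => hUV a hab.1 (hh ▸ hab.2)
    rcases hne.lt_or_gt with hlt | hlt
    · exact ⟨⟨(a, b), hlt⟩, mem_pairsBetween.2 (.inl hab), by simp [hab.1]⟩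
    · have hb : b ∉ U := fun hb => hUV b hb hab.2
      exact ⟨⟨(b, a), hlt⟩, mem_pairsBetween.2 (.inr hab), by simp [hb]⟩

theorem relScore_sub (v z : Fin n → ℝ) (e : SubjectPair n) :
    relScore (v - z) e = relScore v e - relScore z e := by
  simp only [relScore, Pi.sub_apply]
  ring

theorem relScore_add_smul (v z : Fin n → ℝ) (h : ℝ) (e : SubjectPair n) :
    relScore (v + h • z) e = relScore v e + h * relScore z e := by
  simp only [relScore, Pi.add_apply, Pi.smul_apply, smul_eq_mul]
  ring

theorem relScore_smul (h : ℝ) (z : Fin n → ℝ) (e : SubjectPair n) :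
    relScore (h • z) e = h * relScore z e := by
  simp only [relScore, Pi.smul_apply, smul_eq_mul]
  ring

theorem relScore_neg (z : Fin n → ℝ) (e : SubjectPair n) :
    relScore (-z) e = -relScore z e := by
  simp only [relScore, Pi.neg_apply]
  ring

theorem continuous_relScore (e : SubjectPair n) :
    Continuous fun v : Fin n → ℝ => relScore v e :=
  (continuous_apply _).sub (continuous_apply _)

/-- The total `w`-weighted discrepancy of `δ` across the cut between `U` and its complement. -/
def cutFlux (w : SubjectPair n → ℝ) (δ : Fin n → ℝ) (U : Finset (Fin n)) : ℝ :=
  ∑ e ∈ pairsBetween U Uᶜ, w e * |relScore δ e|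

theorem cutFlux_compl (w : SubjectPair n → ℝ) (δ : Fin n → ℝ) (U : Finset (Fin n)) :
    cutFlux w δ Uᶜ = cutFlux w δ U := by
  rw [cutFlux, cutFlux, compl_compl, pairsBetween_comm]

theorem cutFlux_neg (w : SubjectPair n → ℝ) (δ : Fin n → ℝ) (U : Finset (Fin n)) :
    cutFlux w (-δ) U = cutFlux w δ U := by
  simp only [cutFlux, relScore_neg, abs_neg]

/-- The indicator function of `U`, the score vector moving the subjects of `U` together. -/
def indicatorVec (U : Finset (Fin n)) : Fin n → ℝ := fun i => if i ∈ U then 1 else 0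

theorem indicatorVec_of_mem {U : Finset (Fin n)} {i : Fin n} (hi : i ∈ U) :
    indicatorVec U i = 1 := if_pos hi

theorem indicatorVec_of_notMem {U : Finset (Fin n)} {i : Fin n} (hi : i ∉ U) :
    indicatorVec U i = 0 := if_neg hi

theorem relScore_indicatorVec_eq_zero {U : Finset (Fin n)} {e : SubjectPair n}
    (he : e ∉ pairsBetween U Uᶜ) : relScore (indicatorVec U) e = 0 := by
  simp only [mem_pairsBetween, Finset.mem_compl, not_or, not_and, not_not] at he
  simp only [relScore, indicatorVec]
  grind

theorem sq_relScore_indicatorVec {U : Finset (Fin n)} {e : SubjectPair n}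
    (he : e ∈ pairsBetween U Uᶜ) : relScore (indicatorVec U) e ^ 2 = 1 := by
  simp only [mem_pairsBetween, Finset.mem_compl] at he
  rcases he with ⟨h1, h2⟩ | ⟨h1, h2⟩ <;>
    norm_num [relScore, indicatorVec_of_mem h1, indicatorVec_of_notMem h2]

theorem relScore_indicatorVec_compl (U : Finset (Fin n)) (e : SubjectPair n) :
    relScore (indicatorVec Uᶜ) e = -relScore (indicatorVec U) e := by
  simp only [relScore, indicatorVec, Finset.mem_compl]
  split_ifs <;> norm_num

end Cuts

section DynamicRange

variable {n : ℕ}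

theorem dynamicRange_nonneg (z : Fin n → ℝ) : 0 ≤ dynamicRange z :=
  Real.iSup_nonneg fun _ => abs_nonneg _

theorem sub_le_dynamicRange (z : Fin n → ℝ) (i j : Fin n) : z i - z j ≤ dynamicRange z :=
  (le_abs_self _).trans <|
    le_ciSup (f := fun q : Fin n × Fin n => |z q.1 - z q.2|) (Set.finite_range _).bddAbove (i, j)

theorem dynamicRange_le_iff {z : Fin n → ℝ} {r : ℝ} (hr : 0 ≤ r) :
    dynamicRange z ≤ r ↔ ∀ i j, z i - z j ≤ r :=
  ⟨fun h i j => (sub_le_dynamicRange z i j).trans h, fun h =>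
    Real.iSup_le (fun q => abs_sub_le_iff.2 ⟨h q.1 q.2, h q.2 q.1⟩) hr⟩

theorem abs_relScore_le_dynamicRange (z : Fin n → ℝ) (e : SubjectPair n) :
    |relScore z e| ≤ dynamicRange z :=
  abs_sub_le_iff.2 ⟨sub_le_dynamicRange z _ _, sub_le_dynamicRange z _ _⟩

theorem dynamicRange_add_const (z : Fin n → ℝ) (c : ℝ) :
    dynamicRange (fun i => z i + c) = dynamicRange z := by
  simp only [dynamicRange, add_sub_add_right_eq_sub]

theorem continuous_dynamicRange : Continuous (dynamicRange : (Fin n → ℝ) → ℝ) := by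
  rcases isEmpty_or_nonempty (Fin n × Fin n) with _ | _
  · exact continuous_of_const fun _ _ =>
      (Real.iSup_of_isEmpty _).trans (Real.iSup_of_isEmpty _).symm
  · have hsup : (dynamicRange : (Fin n → ℝ) → ℝ) = fun z =>
        Finset.univ.sup' Finset.univ_nonempty fun q : Fin n × Fin n => |z q.1 - z q.2| :=
      funext fun z => (Finset.sup'_univ_eq_ciSup _).symm
    rw [hsup]
    exact Continuous.finset_sup'_apply _ fun q _ => by fun_prop

theorem norm_le_dynamicRange {z : Fin n → ℝ} (hz : z ∈ normalizedScores n) :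
    ‖z‖ ≤ dynamicRange z := by
  refine (pi_norm_le_iff_of_nonneg (dynamicRange_nonneg z)).2 fun i => ?_
  have h0 : z ⟨0, i.pos⟩ = 0 := hz _ rfl
  have h1 := sub_le_dynamicRange z i ⟨0, i.pos⟩
  have h2 := sub_le_dynamicRange z ⟨0, i.pos⟩ i
  rw [Real.norm_eq_abs, abs_le]
  constructor <;> linarith

theorem sub_mem_normalizedScores {v w : Fin n → ℝ} (hv : v ∈ normalizedScores n)
    (hw : w ∈ normalizedScores n) : v - w ∈ normalizedScores n := fun i hi => by
  rw [Pi.sub_apply, hv i hi, hw i hi, sub_zero]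

theorem mem_normalizedScores_iff [NeZero n] {v : Fin n → ℝ} :
    v ∈ normalizedScores n ↔ v 0 = 0 :=
  ⟨fun h => h 0 rfl, fun h _ hi => (congrArg v (Fin.ext hi)).trans h⟩

theorem convex_normalizedScores (n : ℕ) : Convex ℝ (normalizedScores n) := by
  intro v hv w hw a b _ _ _ i hi
  simp [hv i hi, hw i hi]

theorem isClosed_normalizedScores (n : ℕ) : IsClosed (normalizedScores n) := by
  simp only [normalizedScores, Set.ofPred_forall]
  exact isClosed_iInter fun i => isClosed_iInter fun _ =>
    isClosed_eq (continuous_apply i) continuous_const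

end DynamicRange

section LevelSets

variable {n : ℕ}

/-- The subjects at which `δ` is at least `s`. -/
def upperLevel (δ : Fin n → ℝ) (s : ℝ) : Finset (Fin n) :=
  Finset.univ.filter fun i => s ≤ δ i

theorem mem_upperLevel {δ : Fin n → ℝ} {s : ℝ} {i : Fin n} :
    i ∈ upperLevel δ s ↔ s ≤ δ i := by
  simp [upperLevel]

theorem upperLevel_anti (δ : Fin n → ℝ) : Antitone (upperLevel δ) := fun s t h i hi => by
  rw [mem_upperLevel] at hi ⊢
  exact h.trans hi

/-- Every set `U` of subjects sends weight at least `β |U|` out of each of its enlargements `W` that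
has at most `K |U|` elements and at most half of all subjects. -/
def IsExpanding (w : SubjectPair n → ℝ) (K β : ℝ) : Prop :=
  ∀ U W : Finset (Fin n), U ⊆ W → U.Nonempty → (W.card : ℝ) ≤ K * U.card → 2 * W.card ≤ n →
    β * U.card ≤ ∑ e ∈ pairsBetween U Wᶜ, w e

/-- The flux of `δ` out of every nonempty upper level set containing at most half of the subjects
is at most `γ` times the size of the level set. -/
def HasLevelFluxLE (w : SubjectPair n → ℝ) (δ : Fin n → ℝ) (γ : ℝ) : Prop :=
  ∀ s, (upperLevel δ s).Nonempty → 2 * (upperLevel δ s).card ≤ n →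
    cutFlux w δ (upperLevel δ s) ≤ γ * (upperLevel δ s).card

variable {w : SubjectPair n → ℝ} {K β γ d : ℝ} {δ : Fin n → ℝ}

theorem IsExpanding.sum_cut_pos (h : IsExpanding w K β) (hK : 1 ≤ K) (hβ : 0 < β)
    {U : Finset (Fin n)} (hU : U.Nonempty) (hUc : Uᶜ.Nonempty) :
    0 < ∑ e ∈ pairsBetween U Uᶜ, w e := by
  have pos_of_small : ∀ V : Finset (Fin n), V.Nonempty → 2 * V.card ≤ n →
      0 < ∑ e ∈ pairsBetween V Vᶜ, w e := fun V hV hVn => by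
    have hcard : (0 : ℝ) < V.card := by exact_mod_cast hV.card_pos
    exact (mul_pos hβ hcard).trans_le (h V V subset_rfl hV (le_mul_of_one_le_left hcard.le hK) hVn)
  rcases le_or_gt (2 * U.card) n with hUn | hUn
  · exact pos_of_small U hU hUn
  · have hcompl := Finset.card_compl_add_card U
    rw [Fintype.card_fin] at hcompl
    have := pos_of_small Uᶜ hUc (by omega)
    rwa [compl_compl, pairsBetween_comm] at this

theorem mul_sum_le_cutFlux (hw : ∀ e, 0 ≤ w e) (hd : 0 ≤ d) (s : ℝ) :
    d * ∑ e ∈ pairsBetween (upperLevel δ s) (upperLevel δ (s - d))ᶜ, w e ≤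
      cutFlux w δ (upperLevel δ s) := by
  have hsub : upperLevel δ s ⊆ upperLevel δ (s - d) := upperLevel_anti δ (sub_le_self s hd)
  rw [Finset.mul_sum, cutFlux]
  refine (Finset.sum_le_sum fun e he => ?_).trans (Finset.sum_le_sum_of_subset_of_nonneg
    (pairsBetween_mono_right _ (Finset.compl_subset_compl.2 hsub))
    fun e _ _ => mul_nonneg (hw e) (abs_nonneg _))
  rw [mul_comm]
  refine mul_le_mul_of_nonneg_left ?_ (hw e)
  simp only [mem_pairsBetween, Finset.mem_compl, mem_upperLevel, not_le] at he
  rw [relScore, le_abs]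
  rcases he with ⟨ha, hb⟩ | ⟨ha, hb⟩
  · left; linarith
  · right; linarith

theorem IsExpanding.card_upperLevel_sub (hE : IsExpanding w K β) (hw : ∀ e, 0 ≤ w e)
    (hF : HasLevelFluxLE w δ γ) (hd : 0 ≤ d) (hγ : γ < β * d) {s : ℝ}
    (hs : (upperLevel δ s).Nonempty) :
    K * (upperLevel δ s).card < (upperLevel δ (s - d)).card ∨
      n < 2 * (upperLevel δ (s - d)).card := by
  by_contra! ⟨hsmall, hhalf⟩
  have hsub : upperLevel δ s ⊆ upperLevel δ (s - d) := upperLevel_anti δ (sub_le_self s hd)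
  have hcard := Finset.card_le_card hsub
  have hpos : (0 : ℝ) < (upperLevel δ s).card := by exact_mod_cast hs.card_pos
  have hlower : d * (β * (upperLevel δ s).card) ≤ γ * (upperLevel δ s).card :=
    (mul_le_mul_of_nonneg_left (hE _ _ hsub hs hsmall hhalf) hd).trans <|
      (mul_sum_le_cutFlux hw hd s).trans (hF s hs (by omega))
  nlinarith

theorem IsExpanding.half_lt_card_upperLevel (hE : IsExpanding w K β) (hw : ∀ e, 0 ≤ w e)
    (hF : HasLevelFluxLE w δ γ) (hd : 0 ≤ d) (hγ : γ < β * d) (hK : 0 ≤ K) (i : Fin n) {m : ℕ}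
    (hm : (n : ℝ) ≤ K ^ m) : n < 2 * (upperLevel δ (δ i - m * d)).card := by
  have growth : ∀ k : ℕ, K ^ k ≤ (upperLevel δ (δ i - k * d)).card ∨
      n < 2 * (upperLevel δ (δ i - k * d)).card := by
    intro k
    induction k with
    | zero =>
      have : 0 < (upperLevel δ (δ i)).card := Finset.card_pos.2 ⟨i, mem_upperLevel.2 le_rfl⟩
      left
      simpa using this
    | succ k ih =>
      have hne : (upperLevel δ (δ i - k * d)).Nonempty :=
        ⟨i, mem_upperLevel.2 (sub_le_self _ (by positivity))⟩
      have heq : δ i - (k + 1 : ℕ) * d = δ i - k * d - d := by push_cast; ring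
      rw [heq]
      rcases ih with ih | ih
      · refine (hE.card_upperLevel_sub hw hF hd hγ hne).imp_left fun hs => ?_
        rw [pow_succ']
        exact (mul_le_mul_of_nonneg_left ih hK).trans hs.le
      · exact .inr <| ih.trans_le <| Nat.mul_le_mul_left 2 <| Finset.card_le_card <|
          upperLevel_anti δ (sub_le_self _ hd)
  rcases growth m with h | h
  · have hall : n ≤ (upperLevel δ (δ i - m * d)).card := by exact_mod_cast hm.trans h
    have := i.pos
    omega
  · exact h

theorem IsExpanding.dynamicRange_le (hE : IsExpanding w K β) (hw : ∀ e, 0 ≤ w e)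
    (hF : HasLevelFluxLE w δ γ) (hF' : HasLevelFluxLE w (-δ) γ) (hd : 0 ≤ d) (hγ : γ < β * d)
    (hK : 0 ≤ K) {m : ℕ} (hm : (n : ℝ) ≤ K ^ m) : dynamicRange δ ≤ 2 * m * d := by
  refine (dynamicRange_le_iff (by positivity)).2 fun i j => ?_
  have hi := hE.half_lt_card_upperLevel hw hF hd hγ hK i hm
  have hj := hE.half_lt_card_upperLevel hw hF' hd hγ hK j hm
  have hmeet : ¬ Disjoint (upperLevel δ (δ i - m * d)) (upperLevel (-δ) ((-δ) j - m * d)) := by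
    intro hdisj
    have hcard := Finset.card_le_univ
      (upperLevel δ (δ i - m * d) ∪ upperLevel (-δ) ((-δ) j - m * d))
    rw [Finset.card_union_of_disjoint hdisj, Fintype.card_fin] at hcard
    omega
  obtain ⟨k, hk, hk'⟩ := Finset.not_disjoint_iff.1 hmeet
  rw [mem_upperLevel] at hk hk'
  simp only [Pi.neg_apply] at hk'
  linarith

end LevelSets

section Objective

variable {n : ℕ} {ψ φ : ℝ → ℝ} {S W : SubjectPair n → ℝ} {v w z : Fin n → ℝ}

/-- The log-likelihood of a paired comparison model in canonical form, up to a constant: the pair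
`e` has sufficient statistic `S e`, weight `W e` and log-partition function `ψ`. -/
def pairObjective (ψ : ℝ → ℝ) (S W : SubjectPair n → ℝ) (v : Fin n → ℝ) : ℝ :=
  ∑ e, (S e * relScore v e - W e * ψ (relScore v e))

/-- The derivative of `pairObjective ψ S W` at `v` in the direction `z`, where `φ` is the derivative
of `ψ`. -/
def pairScore (φ : ℝ → ℝ) (S W : SubjectPair n → ℝ) (v z : Fin n → ℝ) : ℝ :=
  ∑ e, (S e - W e * φ (relScore v e)) * relScore z e

theorem hasDerivAt_pairObjective (hψ : ∀ y, HasDerivAt ψ (φ y) y) (S W : SubjectPair n → ℝ)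
    (v z : Fin n → ℝ) :
    HasDerivAt (fun h : ℝ => pairObjective ψ S W (v + h • z)) (pairScore φ S W v z) 0 := by
  refine HasDerivAt.fun_sum fun e _ => ?_
  simp only [relScore_add_smul]
  have hline : HasDerivAt (fun h : ℝ => relScore v e + h * relScore z e) (relScore z e) 0 := by
    simpa using ((hasDerivAt_id (0 : ℝ)).mul_const (relScore z e)).const_add (relScore v e)
  have hcomp : HasDerivAt ψ (φ (relScore v e)) (relScore v e + 0 * relScore z e) := by
    simpa using hψ (relScore v e)
  refine ((hline.const_mul (S e)).sub ((hcomp.comp 0 hline).const_mul (W e))).congr_deriv ?_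
  ring

theorem continuous_pairObjective (hψ : Continuous ψ) (S W : SubjectPair n → ℝ) :
    Continuous (pairObjective ψ S W) :=
  continuous_finsetSum _ fun e _ => (continuous_const.mul (continuous_relScore e)).sub
    (continuous_const.mul (hψ.comp (continuous_relScore e)))

theorem concaveOn_pairObjective (hψ : ConvexOn ℝ Set.univ ψ) (S : SubjectPair n → ℝ)
    (hW : ∀ e, 0 ≤ W e) {A : Set (Fin n → ℝ)} (hA : Convex ℝ A) :
    ConcaveOn ℝ A (pairObjective ψ S W) := by
  refine ⟨hA, fun v _ w _ a b ha hb hab => ?_⟩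
  simp only [pairObjective, smul_eq_mul, Finset.mul_sum]
  rw [← Finset.sum_add_distrib]
  refine Finset.sum_le_sum fun e _ => ?_
  have hconv := hψ.2 (Set.mem_univ (relScore v e)) (Set.mem_univ (relScore w e)) ha hb hab
  have hlin : relScore (a • v + b • w) e = a * relScore v e + b * relScore w e := by
    rw [relScore_add_smul, relScore_smul]
  rw [hlin]
  simp only [smul_eq_mul] at hconv
  nlinarith [mul_le_mul_of_nonneg_left hconv (hW e)]

theorem pairObjective_add_const (ψ : ℝ → ℝ) (S W : SubjectPair n → ℝ) (v : Fin n → ℝ) (c : ℝ) :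
    pairObjective ψ S W (fun i => v i + c) = pairObjective ψ S W v := by
  simp only [pairObjective, relScore, add_sub_add_right_eq_sub]

theorem pairScore_neg (φ : ℝ → ℝ) (S W : SubjectPair n → ℝ) (v z : Fin n → ℝ) :
    pairScore φ S W v (-z) = -pairScore φ S W v z := by
  simp only [pairScore, relScore_neg, mul_neg, Finset.sum_neg_distrib]

theorem pairScore_indicatorVec_compl (φ : ℝ → ℝ) (S W : SubjectPair n → ℝ) (v : Fin n → ℝ)
    (U : Finset (Fin n)) :
    pairScore φ S W v (indicatorVec Uᶜ) = -pairScore φ S W v (indicatorVec U) := by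
  simp only [pairScore, relScore_indicatorVec_compl, mul_neg, Finset.sum_neg_distrib]

theorem pairScore_sub_pairScore (φ : ℝ → ℝ) (S W : SubjectPair n → ℝ) (v w z : Fin n → ℝ) :
    pairScore φ S W v z - pairScore φ S W w z =
      ∑ e, W e * ((φ (relScore w e) - φ (relScore v e)) * relScore z e) := by
  simp only [pairScore]
  rw [← Finset.sum_sub_distrib]
  exact Finset.sum_congr rfl fun e _ => by ring

theorem pairScore_nonpos_of_isMaxOn (hψ : ∀ y, HasDerivAt ψ (φ y) y) {A : Set (Fin n → ℝ)}
    (hmax : IsMaxOn (pairObjective ψ S W) A v) (hz : ∀ᶠ h in 𝓝[>] (0 : ℝ), v + h • z ∈ A) :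
    pairScore φ S W v z ≤ 0 := by
  have hloc : IsLocalMaxOn (fun h : ℝ => pairObjective ψ S W (v + h • z))
      {h : ℝ | v + h • z ∈ A} 0 := by
    refine IsMaxOn.localize fun h hh => ?_
    simpa using! hmax hh
  have htan : (1 : ℝ) ∈ posTangentConeAt {h : ℝ | v + h • z ∈ A} 0 :=
    mem_posTangentConeAt_of_frequently_mem <| Eventually.frequently <| by simpa using hz
  simpa using hloc.hasFDerivWithinAt_nonpos
    (hasDerivAt_pairObjective hψ S W v z).hasFDerivAt.hasFDerivWithinAt htan

theorem eq_zero_of_forall_mul_relScore_eq_zero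
    (hW : ∀ U : Finset (Fin n), U.Nonempty → Uᶜ.Nonempty → 0 < ∑ e ∈ pairsBetween U Uᶜ, W e)
    (hz : z ∈ normalizedScores n) (h : ∀ e, W e * relScore z e = 0) : z = 0 := by
  by_contra! hne
  obtain ⟨k, hk⟩ := Function.ne_iff.1 hne
  have hpos := hW (Finset.univ.filter fun i => z i = z k) ⟨k, by simp⟩
    ⟨⟨0, k.pos⟩, by simpa [hz ⟨0, k.pos⟩ rfl] using hk.symm⟩
  obtain ⟨e, he, hWe⟩ := Finset.exists_ne_zero_of_sum_ne_zero hpos.ne'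
  have hze : z e.1.1 = z e.1.2 := sub_eq_zero.1 ((mul_eq_zero.1 (h e)).resolve_left hWe)
  simp [mem_pairsBetween, hze] at he

theorem eq_of_isMaxOn_pairObjective (hψ : ∀ y, HasDerivAt ψ (φ y) y) (hφ : StrictMono φ)
    (hW : ∀ e, 0 ≤ W e)
    (hcut : ∀ U : Finset (Fin n), U.Nonempty → Uᶜ.Nonempty → 0 < ∑ e ∈ pairsBetween U Uᶜ, W e)
    (hv : v ∈ normalizedScores n) (hw : w ∈ normalizedScores n)
    (hvmax : IsMaxOn (pairObjective ψ S W) (normalizedScores n) v)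
    (hwmax : IsMaxOn (pairObjective ψ S W) (normalizedScores n) w) : w = v := by
  have stationary : ∀ {a b : Fin n → ℝ}, a ∈ normalizedScores n → b ∈ normalizedScores n →
      IsMaxOn (pairObjective ψ S W) (normalizedScores n) a → pairScore φ S W a (b - a) ≤ 0 :=
    fun {a b} ha hb hmax => pairScore_nonpos_of_isMaxOn hψ hmax <|
      Eventually.of_forall fun h i hi => by simp [ha i hi, hb i hi]
  have hsum_le : ∑ e, W e * ((φ (relScore w e) - φ (relScore v e)) * relScore (w - v) e) ≤ 0 := by
    have hvw := stationary hv hw hvmax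
    have hwv := stationary hw hv hwmax
    rw [← neg_sub w v, pairScore_neg] at hwv
    rw [← pairScore_sub_pairScore φ S]
    linarith
  have hmono : ∀ {a b : ℝ}, a ≠ b → 0 < (φ b - φ a) * (b - a) := fun {a b} hab => by
    rcases hab.lt_or_gt with hab | hab
    · exact mul_pos (sub_pos.2 (hφ hab)) (sub_pos.2 hab)
    · exact mul_pos_of_neg_of_neg (sub_neg.2 (hφ hab)) (sub_neg.2 hab)
  have hterm : ∀ e, 0 ≤ W e * ((φ (relScore w e) - φ (relScore v e)) * relScore (w - v) e) :=
    fun e => by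
      rw [relScore_sub]
      rcases eq_or_ne (relScore v e) (relScore w e) with hvw | hvw
      · simp [hvw]
      · exact mul_nonneg (hW e) (hmono hvw).le
  have hzero := (Finset.sum_eq_zero_iff_of_nonneg fun e _ => hterm e).1
    (hsum_le.antisymm (Finset.sum_nonneg fun e _ => hterm e))
  refine sub_eq_zero.1 (eq_zero_of_forall_mul_relScore_eq_zero hcut
    (sub_mem_normalizedScores hw hv) fun e => ?_)
  rcases mul_eq_zero.1 (hzero e (Finset.mem_univ e)) with hWe | hprod
  · rw [hWe, zero_mul]
  · rw [relScore_sub] at hprod ⊢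
    rw [sub_eq_zero.2 (not_ne_iff.1 fun hvw => (hmono hvw).ne' hprod).symm, mul_zero]

end Objective

section FirstOrder

variable {n : ℕ} {ψ φ : ℝ → ℝ} {S W : SubjectPair n → ℝ} {u v : Fin n → ℝ} {r κ : ℝ}

theorem eventually_dynamicRange_add_smul_indicatorVec_le {δ : Fin n → ℝ} (hr : 0 ≤ r)
    (hδ : dynamicRange δ ≤ r) {L : Finset (Fin n)} (hL : ∀ i ∈ L, ∀ j ∉ L, δ i < δ j) :
    ∀ᶠ h in 𝓝[>] (0 : ℝ), dynamicRange (δ + h • indicatorVec L) ≤ r := by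
  have hgap : ∀ᶠ h in 𝓝[>] (0 : ℝ), ∀ i ∈ L, ∀ j, j ∉ L → h < δ j - δ i := by
    rw [Filter.eventually_all_finset]
    intro i hi
    rw [eventually_all]
    intro j
    by_cases hj : j ∈ L
    · simp [hj]
    · filter_upwards [Ioo_mem_nhdsGT (sub_pos.2 (hL i hi j hj))] with h hh _ using hh.2
  filter_upwards [hgap, self_mem_nhdsWithin] with h hgap (hpos : 0 < h)
  refine (dynamicRange_le_iff hr).2 fun i j => ?_
  have hij := (sub_le_dynamicRange δ i j).trans hδ
  have hji := (sub_le_dynamicRange δ j i).trans hδ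
  simp only [Pi.add_apply, Pi.smul_apply, smul_eq_mul, indicatorVec]
  split_ifs with hi hj hj
  · linarith
  · linarith [hgap i hi j hj]
  · linarith
  · linarith

theorem mul_cutFlux_le_pairScore_sub (hW : ∀ e, 0 ≤ W e)
    (hκ : ∀ e, κ * |relScore (v - u) e| ≤ |φ (relScore v e) - φ (relScore u e)|) (hφ : Monotone φ)
    {L : Finset (Fin n)} (hL : ∀ i ∈ L, ∀ j ∉ L, (v - u) i < (v - u) j) :
    κ * cutFlux W (v - u) L ≤
      pairScore φ S W v (indicatorVec L) - pairScore φ S W u (indicatorVec L) := by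
  rw [pairScore_sub_pairScore, cutFlux, Finset.mul_sum,
    ← Finset.sum_subset (Finset.subset_univ (pairsBetween L Lᶜ))
      fun e _ he => by rw [relScore_indicatorVec_eq_zero he]; ring]
  refine Finset.sum_le_sum fun e he => ?_
  rw [mul_left_comm]
  refine mul_le_mul_of_nonneg_left ((hκ e).trans ?_) (hW e)
  simp only [mem_pairsBetween, Finset.mem_compl] at he
  rcases he with ⟨hi, hj⟩ | ⟨hi, hj⟩
  · have hδ : relScore v e ≤ relScore u e := by
      have := hL _ hi _ hj
      simp only [relScore, Pi.sub_apply] at this ⊢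
      linarith
    rw [abs_of_nonpos (sub_nonpos.2 (hφ hδ))]
    simp [relScore, indicatorVec_of_mem hi, indicatorVec_of_notMem hj]
  · have hδ : relScore u e ≤ relScore v e := by
      have := hL _ hi _ hj
      simp only [relScore, Pi.sub_apply] at this ⊢
      linarith
    rw [abs_of_nonneg (sub_nonneg.2 (hφ hδ))]
    simp [relScore, indicatorVec_of_mem hi, indicatorVec_of_notMem hj]

theorem mul_abs_relScore_sub_le (hr : 0 ≤ r) (hv : dynamicRange (v - u) ≤ r)
    (hκ : ∀ a b, -(dynamicRange u + r) ≤ a → a ≤ b → b ≤ dynamicRange u + r →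
      κ * (b - a) ≤ φ b - φ a) (e : SubjectPair n) :
    κ * |relScore (v - u) e| ≤ |φ (relScore v e) - φ (relScore u e)| := by
  have hu := abs_le.1 (abs_relScore_le_dynamicRange u e)
  have hδ := abs_le.1 ((abs_relScore_le_dynamicRange (v - u) e).trans hv)
  rw [relScore_sub] at hδ ⊢
  rcases le_total (relScore u e) (relScore v e) with huv | huv
  · rw [abs_of_nonneg (sub_nonneg.2 huv)]
    exact (hκ _ _ (by linarith) huv (by linarith)).trans (le_abs_self _)
  · rw [abs_sub_comm, abs_of_nonneg (sub_nonneg.2 huv), abs_sub_comm]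
    exact (hκ _ _ (by linarith) huv (by linarith)).trans (le_abs_self _)

theorem mul_cutFlux_le_abs_pairScore_of_isMaxOn (hψ : ∀ y, HasDerivAt ψ (φ y) y)
    (hφ : Monotone φ) (hW : ∀ e, 0 ≤ W e) (hr : 0 ≤ r)
    (hκ : ∀ a b, -(dynamicRange u + r) ≤ a → a ≤ b → b ≤ dynamicRange u + r →
      κ * (b - a) ≤ φ b - φ a)
    (hv : dynamicRange (v - u) ≤ r)
    (hmax : IsMaxOn (pairObjective ψ S W) {w | dynamicRange (w - u) ≤ r} v)
    {L : Finset (Fin n)} (hL : ∀ i ∈ L, ∀ j ∉ L, (v - u) i < (v - u) j) :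
    κ * cutFlux W (v - u) L ≤ |pairScore φ S W u (indicatorVec L)| := by
  have hscore : pairScore φ S W v (indicatorVec L) ≤ 0 := by
    refine pairScore_nonpos_of_isMaxOn hψ hmax ?_
    filter_upwards [eventually_dynamicRange_add_smul_indicatorVec_le hr hv hL] with h hh
    simpa only [add_sub_right_comm] using! hh
  have hflux := mul_cutFlux_le_pairScore_sub (S := S) hW (mul_abs_relScore_sub_le hr hv hκ) hφ hL
  linarith [neg_abs_le (pairScore φ S W u (indicatorVec L))]

theorem hasLevelFluxLE_of_isMaxOn (hψ : ∀ y, HasDerivAt ψ (φ y) y)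
    (hφ : Monotone φ) (hW : ∀ e, 0 ≤ W e) (hr : 0 ≤ r) (hκ0 : 0 < κ)
    (hκ : ∀ a b, -(dynamicRange u + r) ≤ a → a ≤ b → b ≤ dynamicRange u + r →
      κ * (b - a) ≤ φ b - φ a)
    (hv : dynamicRange (v - u) ≤ r)
    (hmax : IsMaxOn (pairObjective ψ S W) {w | dynamicRange (w - u) ≤ r} v) {b : ℝ}
    (hb : ∀ U : Finset (Fin n), U.Nonempty → 2 * U.card ≤ n →
      |pairScore φ S W u (indicatorVec U)| ≤ b * U.card) :
    HasLevelFluxLE W (v - u) (b / κ) ∧ HasLevelFluxLE W (-(v - u)) (b / κ) := by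
  constructor
  · intro s hs hsn
    have hL : ∀ i ∈ (upperLevel (v - u) s)ᶜ, ∀ j ∉ (upperLevel (v - u) s)ᶜ,
        (v - u) i < (v - u) j := fun i hi j hj => by
      rw [Finset.mem_compl, mem_upperLevel] at hi hj
      exact (not_le.1 hi).trans_le (not_not.1 hj)
    have hflux := mul_cutFlux_le_abs_pairScore_of_isMaxOn hψ hφ hW hr hκ hv hmax hL
    rw [cutFlux_compl, pairScore_indicatorVec_compl, abs_neg] at hflux
    rw [div_mul_eq_mul_div, le_div_iff₀' hκ0]
    exact hflux.trans (hb _ hs hsn)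
  · intro s hs hsn
    have hL : ∀ i ∈ upperLevel (-(v - u)) s, ∀ j ∉ upperLevel (-(v - u)) s,
        (v - u) i < (v - u) j := fun i hi j hj => by
      rw [mem_upperLevel, Pi.neg_apply] at hi hj
      linarith
    rw [cutFlux_neg, div_mul_eq_mul_div, le_div_iff₀' hκ0]
    exact (mul_cutFlux_le_abs_pairScore_of_isMaxOn hψ hφ hW hr hκ hv hmax hL).trans (hb _ hs hsn)

theorem exists_isMaxOn_dynamicRange_le [NeZero n] (hψ : Continuous ψ) (S W : SubjectPair n → ℝ)
    (hu : u ∈ normalizedScores n) (hr : 0 ≤ r) :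
    ∃ v ∈ normalizedScores n, dynamicRange (v - u) ≤ r ∧
      IsMaxOn (pairObjective ψ S W) {w | dynamicRange (w - u) ≤ r} v := by
  have hclosed : IsClosed (normalizedScores n ∩ {w | dynamicRange (w - u) ≤ r}) :=
    (isClosed_normalizedScores n).inter
      (isClosed_le (continuous_dynamicRange.comp (continuous_sub_right u)) continuous_const)
  have hbounded : Bornology.IsBounded (normalizedScores n ∩ {w | dynamicRange (w - u) ≤ r}) :=
    (Metric.isBounded_iff_subset_closedBall u).2 ⟨r, fun w hw => mem_closedBall_iff_norm.2 <|
      (norm_le_dynamicRange (sub_mem_normalizedScores hw.1 hu)).trans hw.2⟩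
  obtain ⟨v, ⟨hv0, hvr⟩, hvmax⟩ :=
    (Metric.isCompact_of_isClosed_isBounded hclosed hbounded).exists_isMaxOn
      ⟨u, hu, (dynamicRange_le_iff hr).2 fun i j => by simpa using hr⟩
      (continuous_pairObjective hψ S W).continuousOn
  refine ⟨v, hv0, hvr, fun w hw => ?_⟩
  rw [Set.mem_ofPred_eq, ← pairObjective_add_const ψ S W w (-w 0)]
  refine hvmax ⟨mem_normalizedScores_iff.2 (add_neg_cancel _), ?_⟩
  have htranslate : (fun i => w i + -w 0) - u = fun i => (w - u) i + -w 0 := by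
    funext i
    simp only [Pi.sub_apply]
    ring
  rwa [Set.mem_ofPred_eq, htranslate, dynamicRange_add_const]

theorem exists_isMaxOn_pairObjective_of_isExpanding [NeZero n]
    (hψ : ∀ y, HasDerivAt ψ (φ y) y) (hφ : Monotone φ) (hW : ∀ e, 0 ≤ W e)
    (hu : u ∈ normalizedScores n) (hκ0 : 0 < κ)
    (hκ : ∀ a b, -(dynamicRange u + r) ≤ a → a ≤ b → b ≤ dynamicRange u + r →
      κ * (b - a) ≤ φ b - φ a) {K β b d : ℝ} {m : ℕ}
    (hE : IsExpanding W K β) (hK : 0 ≤ K)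
    (hb : ∀ U : Finset (Fin n), U.Nonempty → 2 * U.card ≤ n →
      |pairScore φ S W u (indicatorVec U)| ≤ b * U.card)
    (hd : 0 ≤ d) (hbd : b / κ < β * d) (hm : (n : ℝ) ≤ K ^ m) (hmd : 2 * m * d < r) :
    ∃ v ∈ normalizedScores n, IsMaxOn (pairObjective ψ S W) (normalizedScores n) v ∧
      ‖v - u‖ ≤ 2 * m * d := by
  have hr : 0 ≤ r := (by positivity : 0 ≤ 2 * m * d).trans hmd.le
  have hcont : Continuous ψ := continuous_iff_continuousAt.2 fun y => (hψ y).continuousAt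
  have hconv : ConvexOn ℝ Set.univ ψ := (Monotone.convexOn_univ_of_deriv
    (fun y => (hψ y).differentiableAt) (by rwa [funext fun y => (hψ y).deriv]))
  obtain ⟨v, hv, hvr, hvmax⟩ := exists_isMaxOn_dynamicRange_le hcont S W hu hr
  obtain ⟨hup, hdown⟩ := hasLevelFluxLE_of_isMaxOn hψ hφ hW hr hκ0 hκ hvr hvmax hb
  have hrange : dynamicRange (v - u) ≤ 2 * m * d := hE.dynamicRange_le hW hup hdown hd hbd hK hm
  refine ⟨v, hv, ?_, (norm_le_dynamicRange (sub_mem_normalizedScores hv hu)).trans hrange⟩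
  refine IsMaxOn.of_isLocalMaxOn_of_concaveOn hv ?_
    (concaveOn_pairObjective hconv S hW (convex_normalizedScores n))
  have hnear : ∀ᶠ w in 𝓝 v, dynamicRange (w - u) < r :=
    (continuous_dynamicRange.comp (continuous_sub_right u)).continuousAt.eventually_lt
      continuousAt_const (hrange.trans_lt hmd)
  exact (hnear.mono fun w hw => hvmax hw.le).filter_mono nhdsWithin_le_nhds

end FirstOrder

section Link

/-- The logarithm of `e^{y/2} + θ + e^{-y/2}`, the log-partition function of Davidson's model in
canonical form: an outcome `x` of a comparison with relative score `y` has probability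
proportional to `e^{x y / 2}`, with an extra factor `θ` if `x = 0`. -/
def logPartition (θ y : ℝ) : ℝ := Real.log (2 * Real.cosh (y / 2) + θ)

/-- The derivative of `logPartition θ`, which is half of the mean outcome. -/
def halfMean (θ y : ℝ) : ℝ := Real.sinh (y / 2) / (2 * Real.cosh (y / 2) + θ)

/-- The outcomes of positive probability; ties cannot occur if `θ = 0`. -/
def possibleOutcomes (θ : ℝ) : Set ℤ := {x | x = 1 ∨ x = -1 ∨ x = 0 ∧ 0 < θ}

variable {θ : ℝ}

theorem two_mul_cosh_add_pos (hθ : 0 ≤ θ) (y : ℝ) : 0 < 2 * Real.cosh (y / 2) + θ := by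
  have := Real.cosh_pos (y / 2)
  positivity

theorem hasDerivAt_logPartition (hθ : 0 ≤ θ) (y : ℝ) :
    HasDerivAt (logPartition θ) (halfMean θ y) y := by
  have hhalf : HasDerivAt (fun y : ℝ => y / 2) (1 / 2) y := (hasDerivAt_id y).div_const 2
  have hdenom := (((Real.hasDerivAt_cosh (y / 2)).comp y hhalf).const_mul 2).add_const θ
  refine (hdenom.log (two_mul_cosh_add_pos hθ y).ne').congr_deriv ?_
  simp only [halfMean, Function.comp]
  ring

theorem hasDerivAt_halfMean (hθ : 0 ≤ θ) (y : ℝ) :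
    HasDerivAt (halfMean θ)
      ((1 + θ / 2 * Real.cosh (y / 2)) / (2 * Real.cosh (y / 2) + θ) ^ 2) y := by
  have hhalf : HasDerivAt (fun y : ℝ => y / 2) (1 / 2) y := (hasDerivAt_id y).div_const 2
  have hdenom := (((Real.hasDerivAt_cosh (y / 2)).comp y hhalf).const_mul 2).add_const θ
  refine (((Real.hasDerivAt_sinh (y / 2)).comp y hhalf).div hdenom
    (two_mul_cosh_add_pos hθ y).ne').congr_deriv ?_
  simp only [Function.comp]
  congr 1
  linear_combination Real.cosh_sq (y / 2)

theorem strictMono_halfMean (hθ : 0 ≤ θ) : StrictMono (halfMean θ) := by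
  refine strictMono_of_hasDerivAt_pos (hasDerivAt_halfMean hθ) fun y => ?_
  have := Real.cosh_pos (y / 2)
  positivity

theorem cosh_half_le_exp_half {B y : ℝ} (hy : |y| ≤ B) :
    Real.cosh (y / 2) ≤ Real.exp (B / 2) := by
  rw [Real.cosh_eq]
  have hpos : Real.exp (y / 2) ≤ Real.exp (B / 2) :=
    Real.exp_le_exp.2 (by linarith [le_of_abs_le hy])
  have hneg : Real.exp (-(y / 2)) ≤ Real.exp (B / 2) :=
    Real.exp_le_exp.2 (by linarith [neg_le_of_abs_le hy])
  linarith

theorem exp_neg_div_le_deriv_halfMean (hθ : 0 ≤ θ) {B y : ℝ} (hy : |y| ≤ B) :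
    Real.exp (-B) / (2 + θ) ^ 2 ≤
      (1 + θ / 2 * Real.cosh (y / 2)) / (2 * Real.cosh (y / 2) + θ) ^ 2 := by
  have hB : 1 ≤ Real.exp (B / 2) := Real.one_le_exp (by linarith [(abs_nonneg y).trans hy])
  have := Real.cosh_pos (y / 2)
  have hdenom : (2 * Real.cosh (y / 2) + θ) ^ 2 ≤ Real.exp B * (2 + θ) ^ 2 := by
    calc (2 * Real.cosh (y / 2) + θ) ^ 2
        ≤ (Real.exp (B / 2) * (2 + θ)) ^ 2 := by
          gcongr
          nlinarith [cosh_half_le_exp_half hy]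
      _ = Real.exp B * (2 + θ) ^ 2 := by rw [mul_pow, ← Real.exp_nat_mul]; ring_nf
  rw [Real.exp_neg, inv_eq_one_div, div_div]
  exact div_le_div₀ (by positivity) (le_add_of_nonneg_right (by positivity)) (by positivity) hdenom

theorem mul_sub_le_halfMean_sub (hθ : 0 ≤ θ) {B a b : ℝ} (ha : -B ≤ a) (hab : a ≤ b) (hb : b ≤ B) :
    Real.exp (-B) / (2 + θ) ^ 2 * (b - a) ≤ halfMean θ b - halfMean θ a := by
  refine (convex_Icc (-B) B).mul_sub_le_image_sub_of_le_deriv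
    (fun y _ => (hasDerivAt_halfMean hθ y).continuousAt.continuousWithinAt)
    (fun y _ => (hasDerivAt_halfMean hθ y).differentiableAt.differentiableWithinAt) (fun y hy => ?_)
    a ⟨ha, hab.trans hb⟩ b ⟨ha.trans hab, hb⟩ hab
  rw [interior_Icc] at hy
  rw [(hasDerivAt_halfMean hθ y).deriv]
  exact exp_neg_div_le_deriv_halfMean hθ (abs_le.2 ⟨hy.1.le, hy.2.le⟩)

theorem davidson_denominator (θ y : ℝ) :
    Real.exp y + θ * Real.exp (y / 2) + 1
      = Real.exp (y / 2) * (2 * Real.cosh (y / 2) + θ) := by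
  have hsq : Real.exp (y / 2) * Real.exp (y / 2) = Real.exp y := by
    rw [← Real.exp_add, add_halves]
  have hinv : Real.exp (y / 2) * Real.exp (-(y / 2)) = 1 := by
    rw [← Real.exp_add, add_neg_cancel, Real.exp_zero]
  rw [Real.cosh_eq]
  linear_combination -hsq - hinv

theorem davidson_eq_exp_mul {x : ℤ} (hx : x = 1 ∨ x = -1) (y : ℝ) :
    davidson θ x y = Real.exp (x / 2 * y) / (2 * Real.cosh (y / 2) + θ) := by
  have hexp := Real.exp_ne_zero (y / 2)
  rcases hx with rfl | rfl
  · have hsq : Real.exp y = Real.exp (y / 2) * Real.exp (y / 2) := by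
      rw [← Real.exp_add, add_halves]
    rw [davidson, if_pos rfl, davidson_denominator, hsq, mul_div_mul_left _ _ hexp]
    congr 2
    push_cast
    ring
  · have hneg : ((-1 : ℤ) : ℝ) / 2 * y = -(y / 2) := by push_cast; ring
    rw [davidson, if_neg (by norm_num), if_neg (by norm_num), if_pos rfl, davidson_denominator,
      hneg, Real.exp_neg, inv_eq_one_div, div_div]

theorem davidson_zero (θ y : ℝ) : davidson θ 0 y = θ / (2 * Real.cosh (y / 2) + θ) := by
  rw [davidson, if_neg (by norm_num), if_pos rfl, davidson_denominator, mul_comm θ,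
    mul_div_mul_left _ _ (Real.exp_ne_zero _)]

theorem davidson_sub_davidson (θ y : ℝ) :
    davidson θ 1 y - davidson θ (-1) y = 2 * halfMean θ y := by
  rw [davidson_eq_exp_mul (.inl rfl), davidson_eq_exp_mul (.inr rfl), halfMean, Real.sinh_eq]
  push_cast
  ring_nf

theorem davidson_sum (hθ : 0 ≤ θ) (y : ℝ) :
    davidson θ 1 y + davidson θ (-1) y + davidson θ 0 y = 1 := by
  rw [davidson_eq_exp_mul (.inl rfl), davidson_eq_exp_mul (.inr rfl), davidson_zero, ← add_div,
    ← add_div, div_eq_one_iff_eq (two_mul_cosh_add_pos hθ y).ne', Real.cosh_eq]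
  push_cast
  ring_nf

theorem log_davidson (hθ : 0 ≤ θ) {x : ℤ} (hx : x ∈ possibleOutcomes θ) (y : ℝ) :
    Real.log (davidson θ x y)
      = (x : ℝ) / 2 * y - logPartition θ y + if x = 0 then Real.log θ else 0 := by
  have hpart := (two_mul_cosh_add_pos hθ y).ne'
  rcases or_assoc.2 hx with hx | ⟨rfl, hpos⟩
  · rw [davidson_eq_exp_mul hx, Real.log_div (Real.exp_ne_zero _) hpart, Real.log_exp, logPartition,
      if_neg (by rintro rfl; norm_num at hx), add_zero]
  · rw [davidson_zero, Real.log_div hpos.ne' hpart, logPartition, if_pos rfl]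
    push_cast
    ring

end Link

section Likelihood

variable {θ : ℝ} {T n : ℕ} {N : SubjectPair n → ℕ} {X : SubjectPair n → Fin T → ℤ}

/-- Half of the sum of the observed outcomes of the pair `e`, which is the sufficient statistic of
the pair. -/
def halfOutcomeSum (N : SubjectPair n → ℕ) (X : SubjectPair n → Fin T → ℤ)
    (e : SubjectPair n) : ℝ :=
  ∑ t ∈ Finset.univ.filter (fun t : Fin T => (t : ℕ) < N e), (X e t : ℝ) / 2

theorem card_filter_val_lt_of_le {k : ℕ} (hk : k ≤ T) :
    (Finset.univ.filter (fun t : Fin T => (t : ℕ) < k)).card = k := by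
  rw [Fin.card_filter_val_lt, min_eq_right hk]

theorem logLikelihood_eq_pairObjective_add (hθ : 0 ≤ θ) (hN : ∀ e, N e ≤ T)
    (hX : ∀ e t, X e t ∈ possibleOutcomes θ) :
    ∃ c : ℝ, ∀ v, logLikelihood θ N X v
      = pairObjective (logPartition θ) (halfOutcomeSum N X) (fun e => (N e : ℝ)) v + c := by
  refine ⟨∑ e : SubjectPair n, ∑ t ∈ Finset.univ.filter (fun t : Fin T => (t : ℕ) < N e),
    if X e t = 0 then Real.log θ else 0, fun v => ?_⟩
  rw [logLikelihood, pairObjective, ← Finset.sum_add_distrib]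
  refine Finset.sum_congr rfl fun e _ => ?_
  rw [Finset.sum_congr rfl fun t _ => log_davidson hθ (hX e t) (relScore v e),
    Finset.sum_add_distrib, Finset.sum_sub_distrib, Finset.sum_const,
    card_filter_val_lt_of_le (hN e), nsmul_eq_mul, halfOutcomeSum, Finset.sum_mul]

theorem isMLE_iff_isMaxOn_pairObjective (hθ : 0 ≤ θ) (hN : ∀ e, N e ≤ T)
    (hX : ∀ e t, X e t ∈ possibleOutcomes θ) {v : Fin n → ℝ} :
    IsMLE θ N X v ↔ v ∈ normalizedScores n ∧
      IsMaxOn (pairObjective (logPartition θ) (halfOutcomeSum N X) fun e => (N e : ℝ))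
        (normalizedScores n) v := by
  obtain ⟨c, hc⟩ := logLikelihood_eq_pairObjective_add hθ hN hX
  simp only [IsMLE, isMaxOn_iff, hc, add_le_add_iff_right]

end Likelihood

section ExponentialMoments

variable {Ω : Type*} [MeasurableSpace Ω] {μ : Measure Ω}

theorem lintegral_comp_indepFun {α β : Type*} [MeasurableSpace α] [MeasurableSpace β]
    [IsProbabilityMeasure μ] {A : Ω → α} {B : Ω → β} (hA : Measurable A) (hB : Measurable B)
    (hAB : IndepFun A B μ) {g : α × β → ENNReal} (hg : Measurable g) :
    ∫⁻ ω, g (A ω, B ω) ∂μ = ∫⁻ ω, ∫⁻ ω', g (A ω, B ω') ∂μ ∂μ := by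
  have := Measure.isProbabilityMeasure_map (μ := μ) hA.aemeasurable
  have := Measure.isProbabilityMeasure_map (μ := μ) hB.aemeasurable
  rw [← lintegral_map (μ := μ) hg (hA.prodMk hB),
    (indepFun_iff_map_prod_eq_prod_map_map hA.aemeasurable hB.aemeasurable).1 hAB,
    lintegral_prod _ hg.aemeasurable, lintegral_map hg.lintegral_prod_right' hA]
  exact lintegral_congr fun ω => lintegral_map (hg.comp measurable_prodMk_left) hB

theorem measureReal_le_exp_sub_of_lintegral_exp_le {Z : Ω → ℝ} (hZ : Measurable Z) {c : ℝ}
    (h : ∫⁻ ω, ENNReal.ofReal (Real.exp (Z ω)) ∂μ ≤ ENNReal.ofReal (Real.exp c)) (a : ℝ) :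
    μ.real {ω | a ≤ Z ω} ≤ Real.exp (c - a) := by
  have hmarkov := mul_meas_ge_le_lintegral (μ := μ)
    (f := fun ω => ENNReal.ofReal (Real.exp (Z ω))) (by fun_prop) (ENNReal.ofReal (Real.exp a))
  simp only [ENNReal.ofReal_le_ofReal_iff (Real.exp_pos _).le, Real.exp_le_exp] at hmarkov
  have hreal := ENNReal.toReal_mono ENNReal.ofReal_ne_top (hmarkov.trans h)
  rw [ENNReal.toReal_mul, ENNReal.toReal_ofReal (Real.exp_pos _).le,
    ENNReal.toReal_ofReal (Real.exp_pos _).le] at hreal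
  rwa [Real.exp_sub, le_div_iff₀' (Real.exp_pos _)]

variable {T : ℕ} {p : unitInterval}

theorem integral_exp_binomial (T : ℕ) (p : unitInterval) (c : ℝ) :
    ∫ k : ℕ, Real.exp (c * k) ∂(ProbabilityTheory.binomial T p)
      = (p * Real.exp c + (1 - p)) ^ T := by
  rw [integral_binomial, add_pow, ← Nat.range_succ_eq_Iic]
  refine Finset.sum_congr rfl fun k _ => ?_
  rw [smul_eq_mul, mul_pow, ← Real.exp_nat_mul]
  ring_nf

theorem lintegral_exp_binomial_le {Y : Ω → ℕ}
    (hY : HasLaw Y (ProbabilityTheory.binomial T p) μ) (c : ℝ) :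
    ∫⁻ ω, ENNReal.ofReal (Real.exp (c * Y ω)) ∂μ
      ≤ ENNReal.ofReal (Real.exp (T * p * (Real.exp c - 1))) := by
  rw [← lintegral_map' (f := fun k : ℕ => ENNReal.ofReal (Real.exp (c * k)))
      (measurable_of_countable _).aemeasurable hY.aemeasurable, hY.map_eq,
    ← ofReal_integral_eq_lintegral_ofReal (integrable_binomial _)
      (ae_of_all _ fun k => (Real.exp_pos _).le), integral_exp_binomial, mul_assoc,
    Real.exp_nat_mul]
  refine ENNReal.ofReal_le_ofReal (pow_le_pow_left₀ ?_ ?_ T)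
  · exact add_nonneg (mul_nonneg p.2.1 (Real.exp_pos c).le) (sub_nonneg.2 p.2.2)
  · linarith [Real.add_one_le_exp ((p : ℝ) * (Real.exp c - 1))]

variable {ι : Type*} {Y : ι → Ω → ℕ}

theorem lintegral_exp_sum_binomial_le (hm : ∀ i, Measurable (Y i))
    (hY : ∀ i, HasLaw (Y i) (ProbabilityTheory.binomial T p) μ) (hind : iIndepFun Y μ)
    (s : Finset ι) (c : ι → ℝ) :
    ∫⁻ ω, ENNReal.ofReal (Real.exp (∑ i ∈ s, c i * Y i ω)) ∂μ
      ≤ ENNReal.ofReal (Real.exp (T * p * ∑ i ∈ s, (Real.exp (c i) - 1))) := by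
  have hexp : ∀ i, Measurable fun k : ℕ => ENNReal.ofReal (Real.exp (c i * k)) :=
    fun i => measurable_of_countable _
  simp only [Real.exp_sum, Finset.mul_sum, ENNReal.ofReal_prod_of_nonneg
    fun _ _ => (Real.exp_pos _).le]
  rw [lintegral_prod_eq_prod_lintegral_of_indepFun s
    (fun i ω => ENNReal.ofReal (Real.exp (c i * Y i ω))) (hind.comp _ hexp)
    fun i => (hexp i).comp (hm i)]
  exact Finset.prod_le_prod' fun i _ => lintegral_exp_binomial_le (hY i) (c i)

theorem measureReal_sum_binomial_lt_le (hm : ∀ i, Measurable (Y i))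
    (hY : ∀ i, HasLaw (Y i) (ProbabilityTheory.binomial T p) μ) (hind : iIndepFun Y μ)
    (s : Finset ι) :
    μ.real {ω | ∑ i ∈ s, (Y i ω : ℝ) < T * p * s.card / 2}
      ≤ Real.exp (-(T * p * s.card / 8)) := by
  have := hind.isProbabilityMeasure
  have hcast : ∀ i, Measurable fun ω => (-1 : ℝ) * Y i ω := fun i =>
    (measurable_of_countable fun k : ℕ => (-1 : ℝ) * k).comp (hm i)
  have htail := measureReal_le_exp_sub_of_lintegral_exp_le
    (Finset.measurable_fun_sum s fun i _ => hcast i)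
    (lintegral_exp_sum_binomial_le hm hY hind s fun _ => -1) (-(T * p * s.card / 2))
  refine (measureReal_mono fun ω hω => ?_).trans (htail.trans (Real.exp_le_exp.2 ?_))
  · rw [Set.mem_ofPred_eq] at hω ⊢
    rw [← Finset.mul_sum]
    linarith
  · have hmean : (0 : ℝ) ≤ T * p * s.card :=
      mul_nonneg (mul_nonneg T.cast_nonneg p.2.1) s.card.cast_nonneg
    have hexp : Real.exp (-1) ≤ 3 / 8 := by linarith [Real.exp_neg_one_lt_d9]
    rw [Finset.sum_const, nsmul_eq_mul]
    nlinarith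

end ExponentialMoments

section ScoreNoise

/-- The derivative, at the true score vector `u` and in the direction `z`, of the log-likelihood of
the counts `ν` and outcomes `x`: a sum of centred variables. -/
def scoreNoise (θ : ℝ) {T n : ℕ} (u z : Fin n → ℝ) (ν : SubjectPair n → ℕ)
    (x : SubjectPair n → Fin T → ℤ) : ℝ :=
  ∑ q ∈ Finset.univ.filter (fun q : SubjectPair n × Fin T => (q.2 : ℕ) < ν q.1),
    relScore z q.1 * ((x q.1 q.2 : ℝ) / 2 - halfMean θ (relScore u q.1))

variable {θ : ℝ} {T n : ℕ}

theorem sum_filter_val_lt {M : Type*} [AddCommMonoid M] (ν : SubjectPair n → ℕ)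
    (f : SubjectPair n → Fin T → M) :
    ∑ q ∈ Finset.univ.filter (fun q : SubjectPair n × Fin T => (q.2 : ℕ) < ν q.1), f q.1 q.2
      = ∑ e, ∑ t ∈ Finset.univ.filter (fun t : Fin T => (t : ℕ) < ν e), f e t := by
  simp only [Finset.sum_filter, Fintype.sum_prod_type]

theorem scoreNoise_smul (θ : ℝ) (u : Fin n → ℝ) (c : ℝ) (z : Fin n → ℝ) (ν : SubjectPair n → ℕ)
    (x : SubjectPair n → Fin T → ℤ) :
    scoreNoise θ u (c • z) ν x = c * scoreNoise θ u z ν x := by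
  simp only [scoreNoise, relScore_smul, mul_assoc, Finset.mul_sum]

theorem pairScore_eq_scoreNoise {ν : SubjectPair n → ℕ} (hν : ∀ e, ν e ≤ T)
    (x : SubjectPair n → Fin T → ℤ) (u z : Fin n → ℝ) :
    pairScore (halfMean θ) (halfOutcomeSum ν x) (fun e => (ν e : ℝ)) u z
      = scoreNoise θ u z ν x := by
  rw [pairScore, scoreNoise, sum_filter_val_lt ν fun e t =>
    relScore z e * ((x e t : ℝ) / 2 - halfMean θ (relScore u e))]
  refine Finset.sum_congr rfl fun e _ => ?_
  rw [← Finset.mul_sum, Finset.sum_sub_distrib, Finset.sum_const, card_filter_val_lt_of_le (hν e),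
    nsmul_eq_mul, halfOutcomeSum, mul_comm]

end ScoreNoise

section Davidson

variable {Ω : Type*} [MeasurableSpace Ω] {μ : Measure Ω} {θ : ℝ} {T n : ℕ} {p : unitInterval}
  {u : Fin n → ℝ} {N : SubjectPair n → Ω → ℕ} {X : SubjectPair n → Fin T → Ω → ℤ}

namespace IsDavidsonData

theorem isProbabilityMeasure (D : IsDavidsonData μ θ T p u N X) : IsProbabilityMeasure μ :=
  D.indep_count.isProbabilityMeasure

theorem measurableSet_outcome_eq (D : IsDavidsonData μ θ T p u N X) (e : SubjectPair n)
    (t : Fin T) (x : ℤ) : MeasurableSet {ω | X e t ω = x} :=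
  D.measurable_outcome e t (measurableSet_singleton x)

theorem ae_outcome_eq_one_or_neg_one_or_zero (D : IsDavidsonData μ θ T p u N X) (hθ : 0 ≤ θ)
    (e : SubjectPair n) (t : Fin T) : ∀ᵐ ω ∂μ, X e t ω = 1 ∨ X e t ω = -1 ∨ X e t ω = 0 := by
  have := D.isProbabilityMeasure
  have hm := D.measurableSet_outcome_eq e t
  have hprob : μ.real {ω | X e t ω = 1 ∨ X e t ω = -1 ∨ X e t ω = 0} = 1 := by
    rw [Set.ofPred_or, Set.ofPred_or, measureReal_union _ ((hm (-1)).union (hm 0)),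
      measureReal_union _ (hm 0), D.law_outcome e t 1 (by simp), D.law_outcome e t 0 (by simp),
      D.law_outcome e t (-1) (by simp), ← add_assoc, davidson_sum hθ]
    · exact Set.disjoint_left.2 fun ω (h : _ = _) (h' : _ = _) => by omega
    · exact Set.disjoint_left.2 fun ω (h : _ = _) (h' : _ = _ ∨ _ = _) => by omega
  rw [measureReal_def, ENNReal.toReal_eq_one_iff] at hprob
  exact (mem_ae_iff_prob_eq_one ((hm 1).union ((hm (-1)).union (hm 0)))).2 hprob

theorem ae_outcome_mem_possibleOutcomes (D : IsDavidsonData μ θ T p u N X) (hθ : 0 ≤ θ)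
    (e : SubjectPair n) (t : Fin T) : ∀ᵐ ω ∂μ, X e t ω ∈ possibleOutcomes θ := by
  have := D.isProbabilityMeasure
  have htie : ∀ᵐ ω ∂μ, X e t ω = 0 → 0 < θ := by
    rcases hθ.eq_or_lt with rfl | hpos
    · have hzero := D.law_outcome e t 0 (by simp)
      rw [davidson_zero, zero_div, measureReal_eq_zero_iff] at hzero
      filter_upwards [measure_eq_zero_iff_ae_notMem.1 hzero] with ω hω h
      exact absurd h hω
    · exact ae_of_all _ fun _ _ => hpos
  filter_upwards [D.ae_outcome_eq_one_or_neg_one_or_zero hθ e t, htie] with ω hω hω₀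
  exact hω.imp_right (Or.imp_right fun h => ⟨h, hω₀ h⟩)

theorem integral_outcome (D : IsDavidsonData μ θ T p u N X) (hθ : 0 ≤ θ) (e : SubjectPair n)
    (t : Fin T) : ∫ ω, (X e t ω : ℝ) / 2 ∂μ = halfMean θ (relScore u e) := by
  have := D.isProbabilityMeasure
  have hm := D.measurableSet_outcome_eq e t
  have hind : (fun ω => (X e t ω : ℝ)) =ᵐ[μ] fun ω =>
      Set.indicator {ω | X e t ω = 1} (fun _ => (1 : ℝ)) ω -
        Set.indicator {ω | X e t ω = -1} (fun _ => (1 : ℝ)) ω := by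
    filter_upwards [D.ae_outcome_eq_one_or_neg_one_or_zero hθ e t] with ω hω
    simp only [Set.indicator_apply, Set.mem_ofPred_eq]
    rcases hω with h | h | h <;> norm_num [h]
  rw [integral_div, integral_congr_ae hind, integral_sub
    ((integrable_const _).indicator (hm 1)) ((integrable_const _).indicator (hm (-1))),
    integral_indicator_const _ (hm 1), integral_indicator_const _ (hm (-1)),
    D.law_outcome e t 1 (by simp), D.law_outcome e t (-1) (by simp), smul_eq_mul, smul_eq_mul,
    mul_one, mul_one, davidson_sub_davidson, mul_div_cancel_left₀ _ two_ne_zero]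

theorem hasSubgaussianMGF_outcome (D : IsDavidsonData μ θ T p u N X) (hθ : 0 ≤ θ)
    (e : SubjectPair n) (t : Fin T) :
    HasSubgaussianMGF (fun ω => (X e t ω : ℝ) / 2 - halfMean θ (relScore u e)) (1 / 4) μ := by
  have := D.isProbabilityMeasure
  have hm : Measurable fun ω => (X e t ω : ℝ) / 2 :=
    (measurable_of_countable fun k : ℤ => (k : ℝ) / 2).comp (D.measurable_outcome e t)
  have hmem : ∀ᵐ ω ∂μ, (X e t ω : ℝ) / 2 ∈ Set.Icc (-(1 / 2) : ℝ) (1 / 2) := by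
    filter_upwards [D.ae_outcome_eq_one_or_neg_one_or_zero hθ e t] with ω hω
    rcases hω with h | h | h <;> norm_num [h]
  have hsub := hasSubgaussianMGF_of_mem_Icc hm.aemeasurable hmem
  rw [D.integral_outcome hθ e t] at hsub
  convert hsub using 1
  apply NNReal.eq
  norm_num

theorem lintegral_exp_scoreNoise_le (D : IsDavidsonData μ θ T p u N X) (hθ : 0 ≤ θ)
    (z : Fin n → ℝ) (ν : SubjectPair n → ℕ) :
    ∫⁻ ω, ENNReal.ofReal (Real.exp (scoreNoise θ u z ν fun e t => X e t ω)) ∂μ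
      ≤ ENNReal.ofReal (Real.exp (∑ e, relScore z e ^ 2 / 8 * ν e)) := by
  have hind : iIndepFun (fun (q : SubjectPair n × Fin T) ω => relScore z q.1 *
      ((X q.1 q.2 ω : ℝ) / 2 - halfMean θ (relScore u q.1))) μ :=
    D.indep_outcome.comp (fun q (k : ℤ) => relScore z q.1 *
      ((k : ℝ) / 2 - halfMean θ (relScore u q.1))) fun q => measurable_of_countable _
  have hsub := HasSubgaussianMGF.sum_of_iIndepFun hind
    (s := Finset.univ.filter fun q : SubjectPair n × Fin T => (q.2 : ℕ) < ν q.1)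
    fun q _ => (D.hasSubgaussianMGF_outcome hθ q.1 q.2).const_mul (relScore z q.1)
  have hmgf := hsub.mgf_le 1
  have hint := hsub.integrable_exp_mul 1
  simp only [mgf, one_mul] at hmgf hint
  unfold scoreNoise
  rw [← ofReal_integral_eq_lintegral_ofReal hint (ae_of_all _ fun ω => (Real.exp_pos _).le)]
  refine ENNReal.ofReal_le_ofReal (hmgf.trans (Real.exp_le_exp.2 ?_))
  rw [one_pow, mul_one, NNReal.coe_sum, Finset.sum_div]
  have hpair := sum_filter_val_lt (T := T) ν fun e _ => relScore z e ^ 2 / 8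
  simp only [Finset.sum_const, nsmul_eq_mul] at hpair
  refine le_trans (le_of_eq ?_) (hpair.le.trans (Finset.sum_le_sum fun e _ => ?_))
  · refine Finset.sum_congr rfl fun q _ => ?_
    change relScore z q.1 ^ 2 * ((1 / 4 : NNReal) : ℝ) / 2 = relScore z q.1 ^ 2 / 8
    push_cast
    ring
  · rw [mul_comm, Fin.card_filter_val_lt]
    gcongr
    exact min_le_right _ _

theorem measurable_scoreNoise (D : IsDavidsonData μ θ T p u N X) (z : Fin n → ℝ) :
    Measurable fun ω => scoreNoise θ u z (fun e => N e ω) fun e t => X e t ω := by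
  have hcount : Measurable fun ω e => N e ω := measurable_pi_lambda _ D.measurable_count
  have houtcome : Measurable fun ω e t => X e t ω :=
    measurable_pi_lambda _ fun e => measurable_pi_lambda _ (D.measurable_outcome e)
  have hnoise : Measurable fun r : (SubjectPair n → ℕ) × (SubjectPair n → Fin T → ℤ) =>
    scoreNoise θ u z r.1 r.2 := measurable_of_countable _
  simpa only [Function.comp_def] using hnoise.comp (hcount.prodMk houtcome)

theorem lintegral_exp_scoreNoise_count_le (D : IsDavidsonData μ θ T p u N X) (hθ : 0 ≤ θ)
    (z : Fin n → ℝ) :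
    ∫⁻ ω, ENNReal.ofReal
        (Real.exp (scoreNoise θ u z (fun e => N e ω) fun e t => X e t ω)) ∂μ
      ≤ ENNReal.ofReal (Real.exp (T * p * ∑ e, (Real.exp (relScore z e ^ 2 / 8) - 1))) := by
  have := D.isProbabilityMeasure
  have hfun : Measurable fun r : (SubjectPair n → ℕ) × (SubjectPair n × Fin T → ℤ) =>
      ENNReal.ofReal (Real.exp (scoreNoise θ u z r.1 fun e t => r.2 (e, t))) :=
    measurable_of_countable _
  rw [lintegral_comp_indepFun (measurable_pi_lambda _ D.measurable_count)
    (measurable_pi_lambda _ fun q : SubjectPair n × Fin T => D.measurable_outcome q.1 q.2)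
    D.indep_count_outcome hfun]
  exact (lintegral_mono fun ω => D.lintegral_exp_scoreNoise_le hθ z fun e => N e ω).trans
    (lintegral_exp_sum_binomial_le D.measurable_count D.law_count D.indep_count _ _)

theorem measureReal_le_scoreNoise_le (D : IsDavidsonData μ θ T p u N X) (hθ : 0 ≤ θ)
    (z : Fin n → ℝ) (a : ℝ) :
    μ.real {ω | a ≤ scoreNoise θ u z (fun e => N e ω) fun e t => X e t ω}
      ≤ Real.exp (T * p * ∑ e, (Real.exp (relScore z e ^ 2 / 8) - 1) - a) :=
  have := D.isProbabilityMeasure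
  measureReal_le_exp_sub_of_lintegral_exp_le (D.measurable_scoreNoise z)
    (D.lintegral_exp_scoreNoise_count_le hθ z) a

end IsDavidsonData

theorem sum_exp_sq_relScore_smul_indicatorVec_sub_one_le (U : Finset (Fin n)) {ε : ℝ}
    (hε : |ε| ≤ 1) :
    ∑ e, (Real.exp (relScore ((2 * ε) • indicatorVec U) e ^ 2 / 8) - 1)
      ≤ ε ^ 2 * (n * U.card) := by
  have hsq : ε ^ 2 ≤ 1 := (sq_le_one_iff_abs_le_one ε).2 hε
  have hexp : Real.exp (ε ^ 2 / 2) - 1 ≤ ε ^ 2 := by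
    have hpos : 0 ≤ ε ^ 2 / 2 := by positivity
    have := (abs_le.1 (Real.abs_exp_sub_one_sub_id_le (x := ε ^ 2 / 2)
      (by rw [abs_of_nonneg hpos]; linarith))).2
    nlinarith
  have hcard : ((pairsBetween U Uᶜ).card : ℝ) ≤ n * U.card := by
    rw [card_pairsBetween disjoint_compl_right, Nat.cast_mul, mul_comm]
    gcongr
    simpa using Finset.card_le_univ Uᶜ
  calc ∑ e, (Real.exp (relScore ((2 * ε) • indicatorVec U) e ^ 2 / 8) - 1)
      = ∑ e ∈ pairsBetween U Uᶜ, (Real.exp (ε ^ 2 / 2) - 1) := by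
        rw [← Finset.sum_subset (Finset.subset_univ (pairsBetween U Uᶜ)) fun e _ he => by
          simp [relScore_smul, relScore_indicatorVec_eq_zero he]]
        refine Finset.sum_congr rfl fun e he => ?_
        rw [relScore_smul, mul_pow, sq_relScore_indicatorVec he]
        ring_nf
    _ ≤ ε ^ 2 * (n * U.card) := by
        rw [Finset.sum_const, nsmul_eq_mul, mul_comm]
        gcongr

-- The Chernoff bound with exponential parameter `2 ε`, applied to both signs of the noise.
theorem IsDavidsonData.measureReal_le_abs_scoreNoise_indicatorVec_le
    (D : IsDavidsonData μ θ T p u N X) (hθ : 0 ≤ θ) (U : Finset (Fin n)) {ε : ℝ} (hε0 : 0 < ε)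
    (hε1 : ε ≤ 1) :
    μ.real {ω | ε * (T * p * n) * U.card ≤
        |scoreNoise θ u (indicatorVec U) (fun e => N e ω) fun e t => X e t ω|}
      ≤ 2 * Real.exp (-(ε ^ 2 * (T * p * n) * U.card)) := by
  have := D.isProbabilityMeasure
  have hone : ∀ δ : ℝ, |δ| = ε → μ.real {ω | 2 * ε * (ε * (T * p * n) * U.card) ≤
      scoreNoise θ u ((2 * δ) • indicatorVec U) (fun e => N e ω) fun e t => X e t ω}
      ≤ Real.exp (-(ε ^ 2 * (T * p * n) * U.card)) := fun δ hδ => by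
    refine (D.measureReal_le_scoreNoise_le hθ _ _).trans (Real.exp_le_exp.2 ?_)
    have hmean := mul_le_mul_of_nonneg_left
      (sum_exp_sq_relScore_smul_indicatorVec_sub_one_le U (hδ.trans_le hε1))
      (mul_nonneg T.cast_nonneg p.2.1)
    rw [← sq_abs δ, hδ] at hmean
    linarith
  rw [two_mul]
  refine le_trans (measureReal_mono fun ω hω => ?_) ((measureReal_union_le _ _).trans
    (add_le_add (hone ε (abs_of_pos hε0)) (hone (-ε) (by rw [abs_neg, abs_of_pos hε0]))))
  simp only [Set.mem_union, Set.mem_ofPred_eq, scoreNoise_smul] at hω ⊢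
  have htwo : 0 ≤ 2 * ε := by positivity
  exact (le_abs.1 hω).imp (fun h => mul_le_mul_of_nonneg_left h htwo) fun h => by
    linarith [mul_le_mul_of_nonneg_left h htwo]

end Davidson

section RegularData

variable {T n : ℕ}

/-- The data are possible in Davidson's model, the comparison graph is an expander with expansion
factor `K`, and across every cut the score at the truth `u` is at most `ε` times the expected number
of comparisons across a cut of that size. -/
structure IsRegularData (θ p : ℝ) (u : Fin n → ℝ) (K ε : ℝ) (ν : SubjectPair n → ℕ)
    (x : SubjectPair n → Fin T → ℤ) : Prop where
  count_le : ∀ e, ν e ≤ T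
  outcome_mem : ∀ e t, x e t ∈ possibleOutcomes θ
  expanding : IsExpanding (fun e => (ν e : ℝ)) K (T * p * n / 4)
  noise_lt : ∀ U : Finset (Fin n), U.Nonempty →
    |scoreNoise θ u (indicatorVec U) ν x| < ε * (T * p * n) * U.card

theorem card_mul_half_le_card_pairsBetween_compl {U W : Finset (Fin n)} (hUW : U ⊆ W)
    (hW : 2 * W.card ≤ n) : (U.card : ℝ) * (n / 2) ≤ (pairsBetween U Wᶜ).card := by
  have hWn : (2 : ℝ) * W.card ≤ n := by exact_mod_cast hW
  rw [card_pairsBetween (disjoint_compl_right.mono_left hUW), Nat.cast_mul, Finset.card_compl,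
    Fintype.card_fin, Nat.cast_sub (by omega)]
  gcongr
  linarith

theorem sum_inv_pow_card_le_exp_one (n : ℕ) :
    ∑ U : Finset (Fin n), ((n : ℝ)⁻¹) ^ U.card ≤ Real.exp 1 := by
  have hbinom := Fin.sum_pow_mul_eq_add_pow ((n : ℝ)⁻¹) 1 (n := n)
  simp only [one_pow, mul_one] at hbinom
  calc ∑ U : Finset (Fin n), ((n : ℝ)⁻¹) ^ U.card = ((n : ℝ)⁻¹ + 1) ^ n := hbinom
    _ ≤ Real.exp ((n : ℝ)⁻¹) ^ n := by gcongr; exact Real.add_one_le_exp _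
    _ = Real.exp (n * (n : ℝ)⁻¹) := (Real.exp_nat_mul _ n).symm
    _ ≤ Real.exp 1 := Real.exp_le_exp.2 mul_inv_le_one

theorem exp_neg_mul_log_eq [NeZero n] (k : ℕ) :
    Real.exp (-(k * Real.log n)) = ((n : ℝ)⁻¹) ^ k := by
  rw [← mul_neg, Real.exp_nat_mul, Real.exp_neg, Real.exp_log (Nat.cast_pos.2 (NeZero.pos n))]

theorem measureReal_exists_and_le_sum {Ω ι : Type*} [MeasurableSpace Ω] {μ : Measure Ω}
    [Fintype ι] {Q : ι → Prop} {P : ι → Ω → Prop} {c : ι → ℝ}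
    (hc : ∀ i, 0 ≤ c i) (hP : ∀ i, Q i → μ.real {ω | P i ω} ≤ c i) :
    μ.real {ω | ∃ i, Q i ∧ P i ω} ≤ ∑ i, c i := by
  rw [Set.ofPred_exists]
  refine (measureReal_iUnion_fintype_le _).trans (Finset.sum_le_sum fun i _ => ?_)
  by_cases hQ : Q i
  · simpa only [hQ, true_and] using hP i hQ
  · simpa only [hQ, false_and, Set.ofPred_false, measureReal_empty] using hc i

namespace IsDavidsonData

variable {Ω : Type*} [MeasurableSpace Ω] {μ : Measure Ω} {θ : ℝ} {p : unitInterval}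
  {u : Fin n → ℝ} {N : SubjectPair n → Ω → ℕ} {X : SubjectPair n → Fin T → Ω → ℤ}

theorem measureReal_sum_count_lt_le [NeZero n] (D : IsDavidsonData μ θ T p u N X) (hT : 1 ≤ T)
    {K : ℝ} (hK : (3 + K) * Real.log n ≤ n * p / 16) {U W : Finset (Fin n)} (hUW : U ⊆ W)
    (hU : U.Nonempty) (hWK : (W.card : ℝ) ≤ K * U.card) (hW : 2 * W.card ≤ n) :
    μ.real {ω | ∑ e ∈ pairsBetween U Wᶜ, (N e ω : ℝ) < T * p * n / 4 * U.card}
      ≤ ((n : ℝ)⁻¹) ^ 2 * (((n : ℝ)⁻¹) ^ U.card * ((n : ℝ)⁻¹) ^ W.card) := by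
  have := D.isProbabilityMeasure
  have hp := p.2.1
  have hT' : (1 : ℝ) ≤ T := by exact_mod_cast hT
  have hU' : (1 : ℝ) ≤ U.card := by exact_mod_cast hU.card_pos
  have : 0 ≤ Real.log n := Real.log_natCast_nonneg n
  have hcard := card_mul_half_le_card_pairsBetween_compl hUW hW
  have hmean : (T : ℝ) * p * n / 4 * U.card ≤ T * p * (pairsBetween U Wᶜ).card / 2 := by
    have := mul_le_mul_of_nonneg_left hcard (by positivity : (0 : ℝ) ≤ T * p / 2)
    linarith
  refine (measureReal_mono fun ω (hω : _ < _) => hω.trans_le hmean).trans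
    ((measureReal_sum_binomial_lt_le D.measurable_count D.law_count D.indep_count _).trans ?_)
  rw [← pow_add, ← pow_add, ← exp_neg_mul_log_eq]
  refine Real.exp_le_exp.2 (neg_le_neg ?_)
  push_cast
  calc (2 + ((U.card : ℝ) + W.card)) * Real.log n
      ≤ ((3 + K) * U.card) * Real.log n := by gcongr; linarith
    _ = ((3 + K) * Real.log n) * U.card := by ring
    _ ≤ (n * p / 16) * U.card := by gcongr
    _ = 1 * (p : ℝ) * (U.card * (n / 2)) / 8 := by ring
    _ ≤ T * p * (pairsBetween U Wᶜ).card / 8 := by gcongr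

theorem measureReal_not_isExpanding_le [NeZero n] (D : IsDavidsonData μ θ T p u N X) (hT : 1 ≤ T)
    {K : ℝ} (hK : (3 + K) * Real.log n ≤ n * p / 16) :
    μ.real {ω | ¬ IsExpanding (fun e => (N e ω : ℝ)) K (T * p * n / 4)}
      ≤ ((n : ℝ)⁻¹) ^ 2 * Real.exp 1 ^ 2 := by
  have := D.isProbabilityMeasure
  have hunion := measureReal_exists_and_le_sum
    (Q := fun q : Finset (Fin n) × Finset (Fin n) =>
      q.1 ⊆ q.2 ∧ q.1.Nonempty ∧ (q.2.card : ℝ) ≤ K * q.1.card ∧ 2 * q.2.card ≤ n)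
    (fun q => by positivity)
    fun q hq => D.measureReal_sum_count_lt_le hT hK hq.1 hq.2.1 hq.2.2.1 hq.2.2.2
  refine (measureReal_mono fun ω hω => ?_).trans (hunion.trans ?_)
  · simp only [Set.mem_ofPred_eq, IsExpanding, not_forall, not_le] at hω
    obtain ⟨U, W, hUW, hU, hWK, hW, hlt⟩ := hω
    exact ⟨(U, W), ⟨hUW, hU, hWK, hW⟩, hlt⟩
  · rw [← Finset.mul_sum, Fintype.sum_prod_type]
    simp only [← Finset.sum_mul_sum, ← sq]
    gcongr
    exact sum_inv_pow_card_le_exp_one n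

theorem measureReal_le_abs_scoreNoise_le_pow [NeZero n] (D : IsDavidsonData μ θ T p u N X)
    (hθ : 0 ≤ θ) (hT : 1 ≤ T) {ε : ℝ} (hε0 : 0 < ε) (hε1 : ε ≤ 1)
    (hεn : 3 * Real.log n ≤ ε ^ 2 * (n * p)) {U : Finset (Fin n)} (hU : U.Nonempty) :
    μ.real {ω | ε * (T * p * n) * U.card ≤
        |scoreNoise θ u (indicatorVec U) (fun e => N e ω) fun e t => X e t ω|}
      ≤ 2 * (((n : ℝ)⁻¹) ^ 2 * ((n : ℝ)⁻¹) ^ U.card) := by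
  have hp := p.2.1
  have hT' : (1 : ℝ) ≤ T := by exact_mod_cast hT
  have hU' : (1 : ℝ) ≤ U.card := by exact_mod_cast hU.card_pos
  have : 0 ≤ Real.log n := Real.log_natCast_nonneg n
  refine (D.measureReal_le_abs_scoreNoise_indicatorVec_le hθ U hε0 hε1).trans ?_
  rw [← pow_add, ← exp_neg_mul_log_eq]
  refine mul_le_mul_of_nonneg_left (Real.exp_le_exp.2 (neg_le_neg ?_)) zero_le_two
  push_cast
  calc (2 + (U.card : ℝ)) * Real.log n ≤ (3 * U.card) * Real.log n := by gcongr; linarith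
    _ = (3 * Real.log n) * U.card := by ring
    _ ≤ (ε ^ 2 * (n * p)) * U.card := by gcongr
    _ = ε ^ 2 * (1 * p * n) * U.card := by ring
    _ ≤ ε ^ 2 * (T * p * n) * U.card := by gcongr

theorem measureReal_exists_le_abs_scoreNoise_le [NeZero n] (D : IsDavidsonData μ θ T p u N X)
    (hθ : 0 ≤ θ) (hT : 1 ≤ T) {ε : ℝ} (hε0 : 0 < ε) (hε1 : ε ≤ 1)
    (hεn : 3 * Real.log n ≤ ε ^ 2 * (n * p)) :
    μ.real {ω | ∃ U : Finset (Fin n), U.Nonempty ∧ ε * (T * p * n) * U.card ≤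
        |scoreNoise θ u (indicatorVec U) (fun e => N e ω) fun e t => X e t ω|}
      ≤ 2 * (((n : ℝ)⁻¹) ^ 2 * Real.exp 1) := by
  have := D.isProbabilityMeasure
  refine (measureReal_exists_and_le_sum (fun U => by positivity) fun U hU =>
    D.measureReal_le_abs_scoreNoise_le_pow hθ hT hε0 hε1 hεn hU).trans ?_
  rw [← Finset.mul_sum, ← Finset.mul_sum]
  gcongr
  exact sum_inv_pow_card_le_exp_one n

theorem ae_count_le_and_outcome_mem (D : IsDavidsonData μ θ T p u N X) (hθ : 0 ≤ θ) :
    ∀ᵐ ω ∂μ, (∀ e, N e ω ≤ T) ∧ ∀ e t, X e t ω ∈ possibleOutcomes θ :=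
  (eventually_all.2 fun e => ae_le_of_hasLaw_binomial (D.law_count e)).and
    (eventually_all.2 fun e => eventually_all.2 fun t => D.ae_outcome_mem_possibleOutcomes hθ e t)

theorem measureReal_not_isRegularData_le [NeZero n] (D : IsDavidsonData μ θ T p u N X)
    (hθ : 0 ≤ θ) (hT : 1 ≤ T) {K ε : ℝ} (hK : (3 + K) * Real.log n ≤ n * p / 16)
    (hε0 : 0 < ε) (hε1 : ε ≤ 1) (hεn : 3 * Real.log n ≤ ε ^ 2 * (n * p)) :
    μ.real {ω | ¬ IsRegularData θ p u K ε (fun e => N e ω) fun e t => X e t ω}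
      ≤ 14 / (n : ℝ) ^ 2 := by
  have := D.isProbabilityMeasure
  have hsub : {ω | ¬ IsRegularData θ p u K ε (fun e => N e ω) fun e t => X e t ω} ≤ᵐ[μ]
      ({ω | ¬ IsExpanding (fun e => (N e ω : ℝ)) K (T * p * n / 4)} ∪
        {ω | ∃ U : Finset (Fin n), U.Nonempty ∧ ε * (T * p * n) * U.card ≤
          |scoreNoise θ u (indicatorVec U) (fun e => N e ω) fun e t => X e t ω|} : Set Ω) := by
    filter_upwards [D.ae_count_le_and_outcome_mem hθ] with ω hω hirr
    by_contra hcon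
    obtain ⟨hexp, hnoise⟩ := not_or.1 hcon
    refine hirr ⟨hω.1, hω.2, not_not.1 hexp, fun U hU => ?_⟩
    by_contra hlt
    exact hnoise ⟨U, hU, not_lt.1 hlt⟩
  have hexp_one : Real.exp 1 ≤ 2.72 := by linarith [Real.exp_one_lt_d9]
  calc μ.real {ω | ¬ IsRegularData θ p u K ε (fun e => N e ω) fun e t => X e t ω}
      ≤ ((n : ℝ)⁻¹) ^ 2 * Real.exp 1 ^ 2 + 2 * (((n : ℝ)⁻¹) ^ 2 * Real.exp 1) :=
        (ENNReal.toReal_mono (measure_ne_top _ _) (measure_mono_ae hsub)).trans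
          ((measureReal_union_le _ _).trans (add_le_add (D.measureReal_not_isExpanding_le hT hK)
            (D.measureReal_exists_le_abs_scoreNoise_le hθ hT hε0 hε1 hεn)))
    _ ≤ ((n : ℝ)⁻¹) ^ 2 * 2.72 ^ 2 + 2 * (((n : ℝ)⁻¹) ^ 2 * 2.72) := by gcongr
    _ = ((n : ℝ)⁻¹) ^ 2 * 12.8384 := by ring
    _ ≤ ((n : ℝ)⁻¹) ^ 2 * 14 := by gcongr; norm_num
    _ = 14 / (n : ℝ) ^ 2 := by rw [inv_pow, mul_comm, div_eq_mul_inv]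

end IsDavidsonData

end RegularData

section Consistency

/-- The maximum likelihood estimate exists, is unique, and is within `r` of `u` in the supremum
norm. -/
def HasUniqueMLENear (θ : ℝ) {T n : ℕ} (N : SubjectPair n → ℕ) (X : SubjectPair n → Fin T → ℤ)
    (u : Fin n → ℝ) (r : ℝ) : Prop :=
  ∃ v : Fin n → ℝ, IsMLE θ N X v ∧ (∀ w, IsMLE θ N X w → w = v) ∧ ‖v - u‖ ≤ r

variable {θ : ℝ} {T n : ℕ} {u : Fin n → ℝ}

theorem HasUniqueMLENear.mono {N : SubjectPair n → ℕ} {X : SubjectPair n → Fin T → ℤ} {r s : ℝ}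
    (h : HasUniqueMLENear θ N X u r) (hrs : r ≤ s) : HasUniqueMLENear θ N X u s :=
  let ⟨v, hv, hunique, hnear⟩ := h
  ⟨v, hv, hunique, hnear.trans hrs⟩

theorem HasUniqueMLENear.existsUnique {N : SubjectPair n → ℕ} {X : SubjectPair n → Fin T → ℤ}
    {r : ℝ} (h : HasUniqueMLENear θ N X u r) : ∃! v : Fin n → ℝ, IsMLE θ N X v :=
  let ⟨v, hv, hunique, _⟩ := h
  ⟨v, hv, hunique⟩

theorem HasUniqueMLENear.norm_sub_le {N : SubjectPair n → ℕ} {X : SubjectPair n → Fin T → ℤ}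
    {r : ℝ} (h : HasUniqueMLENear θ N X u r) {v : Fin n → ℝ} (hv : IsMLE θ N X v) :
    ‖v - u‖ ≤ r := by
  obtain ⟨w, -, hunique, hnear⟩ := h
  rwa [hunique v hv]

theorem IsRegularData.hasUniqueMLENear [NeZero n] {p K ε : ℝ} {ν : SubjectPair n → ℕ}
    {x : SubjectPair n → Fin T → ℤ} (R : IsRegularData θ p u K ε ν x) (hθ : 0 ≤ θ) (hT : 1 ≤ T)
    (hp : 0 < p) (hu : u ∈ normalizedScores n) (hK : 1 ≤ K) (hε : 0 < ε) {m : ℕ}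
    (hm : (n : ℝ) ≤ K ^ m)
    (hr : 2 * m * (8 * ε * (2 + θ) ^ 2 * Real.exp (dynamicRange u + 1)) < 1) :
    HasUniqueMLENear θ ν x u (2 * m * (8 * ε * (2 + θ) ^ 2 * Real.exp (dynamicRange u + 1))) := by
  have : (0 : ℝ) < T := by exact_mod_cast hT
  have hn : (0 : ℝ) < n := Nat.cast_pos.2 (NeZero.pos n)
  have hν : ∀ e, (0 : ℝ) ≤ ν e := fun e => Nat.cast_nonneg _
  have hmle := fun v => isMLE_iff_isMaxOn_pairObjective hθ R.count_le R.outcome_mem (v := v)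
  have hscore : ∀ U : Finset (Fin n), U.Nonempty → 2 * U.card ≤ n →
      |pairScore (halfMean θ) (halfOutcomeSum ν x) (fun e => (ν e : ℝ)) u (indicatorVec U)|
        ≤ ε * (T * p * n) * U.card := fun U hU _ => by
    rw [pairScore_eq_scoreNoise R.count_le]
    exact (R.noise_lt U hU).le
  obtain ⟨v, hv, hvmax, hnear⟩ := exists_isMaxOn_pairObjective_of_isExpanding
    (hasDerivAt_logPartition hθ) (strictMono_halfMean hθ).monotone hν hu (by positivity)
    (fun a b ha hab hb => mul_sub_le_halfMean_sub hθ ha hab hb) R.expanding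
    (zero_le_one.trans hK) hscore
    (d := 8 * ε * (2 + θ) ^ 2 * Real.exp (dynamicRange u + 1)) (by positivity)
    (by
      rw [Real.exp_neg, div_div_eq_mul_div, div_inv_eq_mul]
      have : 0 < ε * (T * p * n) * (2 + θ) ^ 2 * Real.exp (dynamicRange u + 1) := by positivity
      linarith)
    hm hr
  refine ⟨v, (hmle v).2 ⟨hv, hvmax⟩, fun w hw => ?_, hnear⟩
  obtain ⟨hwmem, hwmax⟩ := (hmle w).1 hw
  exact eq_of_isMaxOn_pairObjective (hasDerivAt_logPartition hθ) (strictMono_halfMean hθ) hν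
    (fun U hU hUc => R.expanding.sum_cut_pos hK (by positivity) hU hUc) hv hwmem hvmax hwmax

-- Since `log x ≤ 4 x ^ (1 / 4)`, the square of the hypothesis bounds `L ^ 3` by `x ^ (3 / 2)`.
theorem le_sqrt_of_rate_le {L x : ℝ} (hL : 0 ≤ L) (hx : 1 < x)
    (h : √(L / x) * (L / Real.log x) ≤ 1 / 2048) : L ≤ √x / 64 := by
  set y := √(√x)
  have hx0 : 0 < x := zero_lt_one.trans hx
  have hy0 : 0 < y := Real.sqrt_pos.2 (Real.sqrt_pos.2 hx0)
  have hy2 : y ^ 2 = √x := Real.sq_sqrt (Real.sqrt_nonneg x)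
  have hy4 : (y ^ 2) ^ 2 = x := by rw [hy2, Real.sq_sqrt hx0.le]
  have hlog : 0 < Real.log x := Real.log_pos hx
  have hlog_le : Real.log x ≤ 4 * y := by
    rw [← hy4, ← pow_mul, Real.log_pow]
    push_cast
    linarith [Real.log_le_sub_one_of_pos hy0]
  have hsq : L / x * (L / Real.log x) ^ 2 ≤ (1 / 2048) ^ 2 := by
    rw [← Real.sq_sqrt (by positivity : 0 ≤ L / x), ← mul_pow]
    gcongr
  rw [div_pow, div_mul_div_comm, div_le_iff₀ (by positivity)] at hsq
  have hcube : L ^ 3 ≤ (y ^ 2 / 64) ^ 3 :=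
    calc L ^ 3 = L * L ^ 2 := by ring
      _ ≤ (1 / 2048) ^ 2 * (x * Real.log x ^ 2) := hsq
      _ ≤ (1 / 2048) ^ 2 * (x * (4 * y) ^ 2) := by gcongr
      _ = (y ^ 2 / 64) ^ 3 := by rw [← hy4]; ring
  rw [← hy2]
  exact le_of_pow_le_pow_left₀ (by norm_num) (by positivity) hcube

theorem le_sqrt_pow_ceil {x y : ℝ} (hx : 1 < x) (hy : 0 < y) :
    y ≤ √x ^ ⌈2 * (Real.log y / Real.log x)⌉₊ := by
  have hx0 : 0 < x := zero_lt_one.trans hx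
  rw [← Real.log_le_log_iff hy (by positivity), Real.log_pow, Real.log_sqrt hx0.le]
  have hceil : 2 * Real.log y ≤ ⌈2 * (Real.log y / Real.log x)⌉₊ * Real.log x := by
    rw [← div_le_iff₀ (Real.log_pos hx), mul_div_assoc]
    exact Nat.le_ceil _
  linarith

theorem ceil_two_mul_le_three_mul {q : ℝ} (hq : 1 ≤ q) : (⌈2 * q⌉₊ : ℝ) ≤ 3 * q := by
  linarith [Nat.ceil_lt_add_one (by linarith : 0 ≤ 2 * q)]

theorem radius_le_davidsonRate (θ M : ℝ) {p : ℝ} (hq : 1 ≤ Real.log n / Real.log (n * p)) :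
    2 * ⌈2 * (Real.log n / Real.log (n * p))⌉₊ *
        (8 * √(3 * Real.log n / (n * p)) * (2 + θ) ^ 2 * Real.exp (M + 1))
      ≤ 512 * (2 + θ) ^ 2 * davidsonRate n p M := by
  have hε : √(3 * Real.log n / (n * p)) ≤ 2 * √(Real.log n / (n * p)) := by
    rw [mul_div_assoc, Real.sqrt_mul (by norm_num)]
    gcongr
    exact (Real.sqrt_le_left zero_le_two).2 (by norm_num)
  have hexp : Real.exp 1 ≤ 3 := Real.exp_one_lt_three.le
  rw [Real.exp_add, davidsonRate]
  set q := Real.log n / Real.log (n * p)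
  have : 0 ≤ q := zero_le_one.trans hq
  calc 2 * ⌈2 * q⌉₊ * (8 * √(3 * Real.log n / (n * p)) * (2 + θ) ^ 2 *
        (Real.exp M * Real.exp 1))
      ≤ 2 * (3 * q) * (8 * (2 * √(Real.log n / (n * p))) * (2 + θ) ^ 2 * (Real.exp M * 3)) := by
        gcongr
        exact ceil_two_mul_le_three_mul hq
    _ = 288 * ((2 + θ) ^ 2 * (Real.exp M * √(Real.log n / (n * p)) * q)) := by ring
    _ ≤ 512 * ((2 + θ) ^ 2 * (Real.exp M * √(Real.log n / (n * p)) * q)) := by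
        gcongr
        norm_num
    _ = 512 * (2 + θ) ^ 2 * (Real.exp M * √(Real.log n / (n * p)) * q) := by ring

theorem sqrt_mul_le_of_davidsonRate_lt (hθ : 0 ≤ θ) {p M : ℝ} (hM : 0 ≤ M)
    (hq : 0 ≤ Real.log n / Real.log (n * p))
    (hΔ : 512 * (2 + θ) ^ 2 * davidsonRate n p M < 1) :
    √(Real.log n / (n * p)) * (Real.log n / Real.log (n * p)) ≤ 1 / 2048 := by
  rw [davidsonRate, mul_assoc (Real.exp M)] at hΔ
  set ρ := √(Real.log n / (n * p)) * (Real.log n / Real.log (n * p))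
  have : 0 ≤ ρ := mul_nonneg (Real.sqrt_nonneg _) hq
  have : 512 * (2 + 0) ^ 2 * (1 * ρ) ≤ 512 * (2 + θ) ^ 2 * (Real.exp M * ρ) := by
    gcongr
    exact Real.one_le_exp hM
  linarith

section Probability

variable {Ω : Type*} [MeasurableSpace Ω] {μ : Measure Ω}

theorem IsDavidsonData.measureReal_compl_hasUniqueMLENear_le {p : unitInterval}
    {N : SubjectPair n → Ω → ℕ} {X : SubjectPair n → Fin T → Ω → ℤ}
    (D : IsDavidsonData μ θ T p u N X) (hθ : 0 ≤ θ) (hT : 1 ≤ T) (hu : u ∈ normalizedScores n)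
    (hp : 1 < n * (p : ℝ)) (hΔ : 512 * (2 + θ) ^ 2 * davidsonRate n p (dynamicRange u) < 1) :
    μ.real {ω | HasUniqueMLENear θ (fun e => N e ω) (fun e t => X e t ω) u
      (512 * (2 + θ) ^ 2 * davidsonRate n p (dynamicRange u))}ᶜ ≤ 14 / (n : ℝ) ^ 2 := by
  have := D.isProbabilityMeasure
  have hx : (0 : ℝ) < n * p := zero_lt_one.trans hp
  have hn : (0 : ℝ) < n := pos_of_mul_pos_left hx p.2.1
  have : NeZero n := ⟨by rintro rfl; simp at hn⟩
  have hlogx : 0 < Real.log (n * p) := Real.log_pos hp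
  have hlog_le : Real.log (n * p) ≤ Real.log n :=
    Real.log_le_log hx (mul_le_of_le_one_right hn.le p.2.2)
  have hlog : 0 < Real.log n := hlogx.trans_le hlog_le
  have hq : 1 ≤ Real.log n / Real.log (n * p) := (one_le_div hlogx).2 hlog_le
  have hsmall : Real.log n ≤ √(n * p) / 64 := le_sqrt_of_rate_le hlog.le hp
    (sqrt_mul_le_of_davidsonRate_lt hθ (dynamicRange_nonneg u) (zero_le_one.trans hq) hΔ)
  have hK : 1 ≤ √(n * (p : ℝ)) := Real.one_le_sqrt.2 hp.le
  have hKsq : √(n * (p : ℝ)) * √(n * p) = n * p := Real.mul_self_sqrt hx.le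
  have hε0 : 0 < √(3 * Real.log n / (n * p)) := Real.sqrt_pos.2 (by positivity)
  have hε1 : √(3 * Real.log n / (n * p)) ≤ 1 :=
    Real.sqrt_le_one.2 ((div_le_one hx).2 (by nlinarith))
  have hradius := radius_le_davidsonRate θ (dynamicRange u) hq
  refine le_trans (measureReal_mono fun ω hω => ?_) (D.measureReal_not_isRegularData_le
    (K := √(n * p)) hθ hT (by nlinarith) hε0 hε1 ?_)
  · exact fun hR => hω <| (hR.hasUniqueMLENear hθ hT (pos_of_mul_pos_right hx hn.le) hu hK hε0
      (le_sqrt_pow_ceil hp hn) (hradius.trans_lt hΔ)).mono hradius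
  · rw [Real.sq_sqrt (by positivity), div_mul_cancel₀ _ hx.ne']

theorem one_sub_measureReal_compl_le [IsProbabilityMeasure μ] (s : Set Ω) :
    1 - μ.real sᶜ ≤ μ.real s := by
  have h := measureReal_union_le (μ := μ) s sᶜ
  rw [Set.union_compl_self, probReal_univ] at h
  linarith

theorem ae_eventually_of_measureReal_compl_le [IsFiniteMeasure μ] {E : ℕ → Set Ω} {a : ℕ → ℝ}
    (ha : Summable a) (h : ∀ᶠ n in atTop, μ.real (E n)ᶜ ≤ a n) :
    ∀ᵐ ω ∂μ, ∀ᶠ n in atTop, ω ∈ E n := by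
  obtain ⟨n₀, hn₀⟩ := eventually_atTop.1 h
  have hne : ∑' n, μ (E (n + n₀))ᶜ ≠ ⊤ := by
    refine ne_top_of_le_ne_top ((summable_nat_add_iff n₀).2 ha).tsum_ofReal_ne_top
      (ENNReal.tsum_le_tsum fun n => ?_)
    rw [← ofReal_measureReal]
    exact ENNReal.ofReal_le_ofReal (hn₀ _ (Nat.le_add_left n₀ n))
  filter_upwards [ae_eventually_notMem hne] with ω hω
  simp only [Set.notMem_compl_iff] at hω
  rwa [← map_add_atTop_eq_nat n₀, eventually_map]

end Probability

theorem eventually_one_lt_mul_of_le {p : ℕ → ℝ} {c : ℝ} (hc : 0 < c)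
    (h : ∀ᶠ n : ℕ in atTop, c * (Real.log n / n) ≤ p n) : ∀ᶠ n : ℕ in atTop, 1 < n * p n := by
  have hlog : Tendsto (fun n : ℕ => c * Real.log n) atTop atTop :=
    (Real.tendsto_log_atTop.comp tendsto_natCast_atTop_atTop).const_mul_atTop hc
  filter_upwards [h, hlog.eventually_gt_atTop 1, eventually_gt_atTop 0] with n hp hn hpos
  calc 1 < c * Real.log n := hn
    _ = n * (c * (Real.log n / n)) := by field_simp
    _ ≤ n * p n := by gcongr

end Consistency

theorem mainTheorem9_general (θ : ℝ) (hθ : 0 ≤ θ) :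
    ∃ C : ℝ, 0 < C ∧ ∀ T : ℕ, 1 ≤ T →
      ∀ (Ω : Type*) [MeasurableSpace Ω] (μ : Measure Ω)
        (p : ℕ → unitInterval) (u : (n : ℕ) → Fin n → ℝ)
        (N : (n : ℕ) → SubjectPair n → Ω → ℕ)
        (X : (n : ℕ) → SubjectPair n → Fin T → Ω → ℤ),
        (∀ n, u n ∈ normalizedScores n) →
        (∀ n, IsDavidsonData μ θ T (p n) (u n) (N n) (X n)) →
        (∀ᶠ n : ℕ in atTop, 1 < n * (p n : ℝ)) →
        Tendsto (fun n : ℕ => davidsonRate n (p n) (dynamicRange (u n))) atTop (𝓝 0) →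
        (∀ᶠ n : ℕ in atTop,
          1 - 14 / (n : ℝ) ^ 2 ≤ μ.real {ω |
            HasUniqueMLENear θ (fun e => N n e ω) (fun e t => X n e t ω) (u n)
              (C * davidsonRate n (p n) (dynamicRange (u n)))}) ∧
        (∀ᵐ ω ∂μ, ∀ᶠ n : ℕ in atTop,
          ∃! v : Fin n → ℝ, IsMLE θ (fun e => N n e ω) (fun e t => X n e t ω) v) ∧
        (∀ uhat : (n : ℕ) → Ω → Fin n → ℝ,
          (∀ n ω, (∃! v : Fin n → ℝ, IsMLE θ (fun e => N n e ω) (fun e t => X n e t ω) v) →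
            IsMLE θ (fun e => N n e ω) (fun e t => X n e t ω) (uhat n ω)) →
          ∀ᵐ ω ∂μ, Tendsto (fun n => ‖uhat n ω - u n‖) atTop (𝓝 0)) := by
  refine ⟨512 * (2 + θ) ^ 2, by positivity, fun T hT Ω _ μ p u N X hu D hp hΔ => ?_⟩
  have := (D 0).isProbabilityMeasure
  have hCΔ : Tendsto (fun n : ℕ => 512 * (2 + θ) ^ 2 * davidsonRate n (p n) (dynamicRange (u n)))
      atTop (𝓝 0) := by
    simpa only [mul_zero] using hΔ.const_mul (512 * (2 + θ) ^ 2)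
  set E : ℕ → Set Ω := fun n =>
    {ω | HasUniqueMLENear θ (fun e => N n e ω) (fun e t => X n e t ω) (u n)
      (512 * (2 + θ) ^ 2 * davidsonRate n (p n) (dynamicRange (u n)))}
  have hbad : ∀ᶠ n : ℕ in atTop, μ.real (E n)ᶜ ≤ 14 / (n : ℝ) ^ 2 := by
    filter_upwards [hp, hCΔ.eventually_lt_const one_pos] with n hpn hΔn
    exact (D n).measureReal_compl_hasUniqueMLENear_le hθ hT (hu n) hpn hΔn
  have hgood : ∀ᵐ ω ∂μ, ∀ᶠ n in atTop, ω ∈ E n := ae_eventually_of_measureReal_compl_le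
    ((Real.summable_nat_pow_inv.2 one_lt_two).mul_left 14) hbad
  refine ⟨hbad.mono fun n hn => ?_, hgood.mono fun ω hω => hω.mono fun n hn => hn.existsUnique,
    fun uhat huhat => hgood.mono fun ω hω => ?_⟩
  · exact (sub_le_sub_left hn 1).trans (one_sub_measureReal_compl_le (E n))
  · exact squeeze_zero' (.of_forall fun n => norm_nonneg _)
      (hω.mono fun n hn => hn.norm_sub_le (huhat n ω hn.existsUnique)) hCΔ

end

theorem mainTheorem9 (θ : ℝ) (hθ : 0 < θ) (T : ℕ) (hT : 1 ≤ T) :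
    ∃ C : ℝ, 0 < C ∧
      ∀ (Ω : Type*) [MeasurableSpace Ω] (μ : Measure Ω) [IsProbabilityMeasure μ]
        (p : ℕ → unitInterval) (u : (n : ℕ) → Fin n → ℝ)
        (N : (n : ℕ) → SubjectPair n → Ω → ℕ)
        (X : (n : ℕ) → SubjectPair n → Fin T → Ω → ℤ),
        (∀ n, u n ∈ normalizedScores n) →
        (∀ n, IsDavidsonData μ θ T (p n) (u n) (N n) (X n)) →
        (∃ c : ℝ, 1 < c ∧ ∀ᶠ n : ℕ in atTop, c * (Real.log n / n) ≤ p n) →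
        Tendsto (fun n : ℕ => davidsonRate n (p n) (dynamicRange (u n))) atTop (𝓝 0) →
        -- unique existence and uniform error bound with high probability
        (∀ᶠ n : ℕ in atTop,
          1 - 14 / (n : ℝ) ^ 2 ≤ μ.real {ω | ∃ v : Fin n → ℝ,
            IsMLE θ (fun e => N n e ω) (fun e t => X n e t ω) v ∧
            (∀ w, IsMLE θ (fun e => N n e ω) (fun e t => X n e t ω) w → w = v) ∧
            ‖v - u n‖ ≤ C * davidsonRate n (p n) (dynamicRange (u n))}) ∧
        -- almost surely, unique existence for all but finitely many `n`
        (∀ᵐ ω ∂μ, ∀ᶠ n : ℕ in atTop,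
          ∃! v : Fin n → ℝ, IsMLE θ (fun e => N n e ω) (fun e t => X n e t ω) v) ∧
        -- almost surely, convergence of the MLE in the supremum norm
        (∀ uhat : (n : ℕ) → Ω → Fin n → ℝ,
          (∀ n ω, (∃! v : Fin n → ℝ, IsMLE θ (fun e => N n e ω) (fun e t => X n e t ω) v) →
            IsMLE θ (fun e => N n e ω) (fun e t => X n e t ω) (uhat n ω)) →
          ∀ᵐ ω ∂μ, Tendsto (fun n => ‖uhat n ω - u n‖) atTop (𝓝 0)) := by
  obtain ⟨C, hC, h⟩ := mainTheorem9_general θ hθ.le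
  exact ⟨C, hC, fun Ω _ μ _ p u N X hu D ⟨c, hc, hp⟩ =>
    h T hT Ω μ p u N X hu D (eventually_one_lt_mul_of_le (zero_lt_one.trans hc) hp)⟩
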